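/- Let $k$ be a field of characteristic $\neq 2$ with algebraic closure $\bar k$, let $f=\sum_{j=0}^{8} f_jx^j\in k[x]$ be a polynomial of degree $7$ or $8$ without multiple roots in $\bar k$, and let $X$ be the hyperelliptic curve of genus $3$ given by $y^2=F(x,z)$ in the weighted projective plane with weights $1,4,1$ for $x,y,z$, where $F$ is the homogenisation of $f$ in degree $8$. Let $\iota$ be the hyperelliptic involution, $D_\infty$ the sum of the two points at infinity if $\deg f=8$ and twice the point at infinity if $\deg f=7$, and $J$ the Jacobian of $X$. An effective divisor $D$ on $X$ is in general position if there is no point $P$ with $D\ge (P)+(\iota P)$. Let $\kappa\colon J\to\mathbb{P}^7$ be the map onto the Kummer variety of $J$ given as follows: - $\kappa(0)=(0:\dots:0:1)$. - If $Q=[D_Q-2D_\infty]$ with $D_Q$ of degree $4$ in general position, represented by binary forms $A=\sum a_ix^iz^{4-i}$, $B=\sum b_ix^iz^{4-i}$, $C=\sum c_ix^iz^{4-i}$ with $B^2-F=AC$ (the form $A$ cuts out the image of $D_Q$ in $\mathbb{P}^1$, and $y=B(x,z)$ at the points of $D_Q$), put $c_{ij}=2b_ib_j-a_ic_j-a_jc_i$;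 then $\kappa(Q)=(\xi_1:\dots:\xi_8)=(1:c_{24}:c_{14}:c_{04}:c_{04}+c_{13}:c_{03}:c_{02}:\xi_2\xi_7-\xi_3\xi_6+\xi_4\xi_5)$. - If $Q=[D_Q-D_\infty]$ with $D_Q=(P_1)+(P_2)$ in general position and $P_i=(x_i,y_i)$ affine, then $$\kappa(Q)=\left(0:1:-(x_1+x_2):x_1x_2:x_1^2+x_1x_2+x_2^2:-(x_1+x_2)x_1x_2:(x_1x_2)^2:\xi_8\right),$$ where, with $G(x_1,x_2)=2\sum_{j=0}^4f_{2j}(x_1x_2)^j+(x_1+x_2)\sum_{j=0}^3f_{2j+1}(x_1x_2)^j$, we have $\xi_8=\frac{2y_1y_2-G(x_1,x_2)}{(x_1-x_2)^2}$ if $x_1\ne x_2$, and $\xi_8=-s_0(x_1,x_1)/(2G(x_1,x_1))$ if $x_1=x_2$, $s_0$ being the polynomial $(G(x_1,x_2)^2-4f(x_1)f(x_2))/(x_1-x_2)^2$. - If $Q=[D_Q-D_\infty]$ with $D_Q$ in general position and $D_Q=((x_1,y_1))+((1:w:0))$, then $\kappa(Q)=(0:0:0:0:1:-x_1:x_1^2:2y_1w-2f_8x_1^4-f_7x_1^3)$;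 if $D_Q=2((1:w:0))$, then $\kappa(Q)=(0:0:0:0:0:0:4f_8:4f_6f_8-f_7^2)$. **Lemma.** Let $R=(\xi_1:\dots:\xi_8)$ be a $k$-rational point of the Kummer variety $\kappa(J)$ with $\xi_1=0$ and $\xi_2\neq0$, and let $Q\in J(\bar k)$ satisfy $\kappa(Q)=R$ and $Q=[D_Q-D_\infty]$, where $D_Q=(x_1,y_1)+(x_2,y_2)$ is in general position with affine points $(x_i,y_i)\in X(\bar k)$. Then $\kappa^{-1}(R)\subset J(k)$ if and only if $y_1+y_2\in k$ and one of the following holds: 1. $x_1=x_2$; 2. $x_1\neq x_2$ and $\dfrac{y_1-y_2}{x_1-x_2}\in k$. -/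

import Mathlib

open Polynomial
open scoped LinearAlgebra.Projectivization

namespace G3Kummer

noncomputable section

/-! ### The curve `y² = f(x)` and its points

`K` is a field and `f ∈ K[x]` has degree `7` or `8`; `F(x, z)` is the homogenisation of `f` in
degree `8`, and the curve is `y² = F(x, z)` in the weighted projective plane with weights
`1, 4, 1` for `x, y, z`. -/

section Curve

variable {K : Type*} [Field K]

/-- The `K`-points of the curve `y² = F(x, z)`: the affine points `(x : y : 1)` and
the points at infinity `(1 : w : 0)`. -/
inductive Pt (f : K[X]) : Type _
  | affine (x y : K) (h : y ^ 2 = f.eval x) : Pt f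
  | infinity (w : K) (h : w ^ 2 = f.coeff 8) : Pt f

namespace Pt

variable {f : K[X]}

/-- The coordinate `x` of the normalised representative of a point. -/
def x : Pt f → K
  | affine x _ _ => x
  | infinity _ _ => 1

/-- The coordinate `y` of the normalised representative of a point. -/
def y : Pt f → K
  | affine _ y _ => y
  | infinity w _ => w

/-- The coordinate `z` of the normalised representative of a point. -/
def z : Pt f → K
  | affine _ _ _ => 1
  | infinity _ _ => 0

/-- The hyperelliptic involution `(x : y : z) ↦ (x : -y : z)`. -/
def inv : Pt f → Pt f
  | affine x y h => affine x (-y) (by rw [neg_sq, h])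
  | infinity w h => infinity (-w) (by rw [neg_sq, h])

end Pt

/-- The ring `K[x, y] / (y² - g(x))`. For `g = f` this is the coordinate ring of the chart `z ≠ 0`;
for `g = F(1, u)` it is the coordinate ring of the chart `x ≠ 0`, with coordinates `u = z / x` and
`v = y / x⁴`. -/
abbrev CoordRing (g : K[X]) : Type _ := AdjoinRoot ((X : K[X][X]) ^ 2 - C g)

/-- The function `a(x) + b(x) y` on the affine curve `y² = g(x)`. -/
def coordFun (g a b : K[X]) : CoordRing g :=
  AdjoinRoot.mk _ (C a + C b * X)

/-- The maximal ideal `(x - x₀, y - y₀)` of the point `(x₀, y₀)` of `y² = g(x)`. -/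
def pointIdeal (g : K[X]) (x₀ y₀ : K) : Ideal (CoordRing g) :=
  Ideal.span {AdjoinRoot.mk _ (C (X - C x₀)), AdjoinRoot.mk _ (X - C (C y₀))}

/-- A form `a(x, z) + b(x, z) y` of weighted degree `e + 4` with nonzero restriction to the curve;
the binary forms `a` and `b` of degrees `e + 4` and `e` are given by
`a(x, 1)` and `b(x, 1)`. (Up to multiples of the equation of the curve every form is of
this shape.) -/
structure CurveForm (K : Type*) [Field K] (e : ℕ) where
  /-- the binary form `a`, dehomogenised -/
  a : K[X]
  /-- the binary form `b`, dehomogenised -/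
  b : K[X]
  natDegree_a : a.natDegree ≤ e + 4
  natDegree_b : b.natDegree ≤ e
  ne_zero : a ≠ 0 ∨ b ≠ 0

/-- The form `G` vanishes to order exactly `n` at the point `P`: in the chart `z ≠ 0`, respectively
`x ≠ 0`, it lies in the `n`-th but not in the `(n + 1)`-st power of the maximal ideal of `P`. -/
def HasOrderAt {f : K[X]} {e : ℕ} (G : CurveForm K e) (n : ℕ) : Pt f → Prop
  | .affine x₀ y₀ _ =>
      coordFun f G.a G.b ∈ pointIdeal f x₀ y₀ ^ n ∧
      coordFun f G.a G.b ∉ pointIdeal f x₀ y₀ ^ (n + 1)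
  | .infinity w _ =>
      coordFun (f.reflect 8) (G.a.reflect (e + 4)) (G.b.reflect e) ∈
        pointIdeal (f.reflect 8) 0 w ^ n ∧
      coordFun (f.reflect 8) (G.a.reflect (e + 4)) (G.b.reflect e) ∉
        pointIdeal (f.reflect 8) 0 w ^ (n + 1)

/-! ### Divisors and the Jacobian -/

/-- Divisors on the curve over (an algebraically closed field) `K`. -/
abbrev Divisor (f : K[X]) : Type _ := Pt f →₀ ℤ

/-- `D` is the divisor of a nonzero rational function, i.e. of a quotient `G / H` of two forms of
the same degree that do not vanish identically on the curve. -/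
def IsPrincipal {f : K[X]} (D : Divisor f) : Prop :=
  ∃ (e : ℕ) (G H : CurveForm K e), ∀ P : Pt f,
    ∃ m n : ℕ, HasOrderAt G m P ∧ HasOrderAt H n P ∧ D P = (m : ℤ) - (n : ℤ)

/-- The group of principal divisors (generated by, and in fact equal to, the set of divisors of
rational functions). -/
def principalDivisors (f : K[X]) : AddSubgroup (Divisor f) :=
  AddSubgroup.closure {D | IsPrincipal D}

/-- The divisor class group of the curve over `K`. -/
abbrev Pic (f : K[X]) : Type _ := Divisor f ⧸ principalDivisors f

/-- The class of a divisor. -/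
def divClass {f : K[X]} (D : Divisor f) : Pic f := QuotientAddGroup.mk' (principalDivisors f) D

/-- The (points over the algebraically closed field `K` of the) Jacobian `Pic⁰`: the group of
classes of divisors of degree `0`. -/
def jac (f : K[X]) : AddSubgroup (Pic f) :=
  ((Finsupp.degree : Divisor f →+ ℤ).ker).map (QuotientAddGroup.mk' (principalDivisors f))

/-- A divisor is in general position if it is effective and there is no point `P` such that
`D ≥ (P) + (ι P)`. -/
def InGeneralPosition {f : K[X]} (D : Divisor f) : Prop :=
  0 ≤ D ∧ ¬ ∃ P : Pt f, Finsupp.single P 1 + Finsupp.single P.inv 1 ≤ D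

/-- The divisor at infinity `D_∞`: the sum `(∞₁) + (∞₂)` of the two points at infinity
`(1 : ± w : 0)`, which is `2(∞)` if `deg f = 7`. -/
def divInfty [IsAlgClosed K] (f : K[X]) : Divisor f :=
  let h := IsAlgClosed.exists_pow_nat_eq (f.coeff 8) (n := 2) two_pos
  Finsupp.single (Pt.infinity h.choose h.choose_spec) 1 +
    Finsupp.single (Pt.infinity h.choose h.choose_spec).inv 1

/-- `Q = [D_Q - D_∞]` with `D_Q = (P₁) + (P₂)` in general position: the point `Q` has degree `2`. -/
def IsDegTwoRep [IsAlgClosed K] {f : K[X]} (Q : jac f) (P₁ P₂ : Pt f) : Prop :=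
  InGeneralPosition (Finsupp.single P₁ 1 + Finsupp.single P₂ 1 : Divisor f) ∧
    (Q : Pic f) = divClass (Finsupp.single P₁ 1 + Finsupp.single P₂ 1 - divInfty f)

/-- The value at `(x, z)` of the binary form of degree `4` with dehomogenisation `b`. -/
def quarticEval (b : K[X]) (x z : K) : K :=
  ∑ i ∈ Finset.range 5, b.coeff i * x ^ i * z ^ (4 - i)

/-- The triple `(A, B, C)` of binary forms of degree `4` (given by their dehomogenisations) with
`B² - F = A C` is a Mumford representation of the divisor `D` of degree `4`: writing
`D = ∑ (Pᵢ)`, the roots of `A` are the images of the `Pᵢ` in the projective line with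
multiplicities, and `B` takes the value `y(Pᵢ)` at `Pᵢ`. -/
def IsMumfordRep {f : K[X]} (A B C' : K[X]) (D : Divisor f) : Prop :=
  A.natDegree ≤ 4 ∧ B.natDegree ≤ 4 ∧ C'.natDegree ≤ 4 ∧ B ^ 2 - f = A * C' ∧
  ∃ P : Fin 4 → Pt f, D = ∑ i, Finsupp.single (P i) 1 ∧
    (∃ c : K, c ≠ 0 ∧ A = C c * ∏ i, (C (P i).z * X - C (P i).x)) ∧
    ∀ i, quarticEval B (P i).x (P i).z = (P i).y

/-- `Q = [D_Q - 2 D_∞]` with `D_Q` of degree `4` in general position, with Mumford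
representation `(A, B, C)`. -/
def IsDegFourRep [IsAlgClosed K] {f : K[X]} (Q : jac f) (T : K[X] × K[X] × K[X]) : Prop :=
  ∃ D : Divisor f, InGeneralPosition D ∧ (Q : Pic f) = divClass (D - 2 • divInfty f) ∧
    IsMumfordRep T.1 T.2.1 T.2.2 D

/-! ### The map to the Kummer variety -/

/-- The polynomial `G(x₁, x₂) = 2 ∑ f_{2j} (x₁x₂)^j + (x₁ + x₂) ∑ f_{2j+1} (x₁x₂)^j`, evaluated in
a commutative `K`-algebra. -/
def polyG {S : Type*} [CommRing S] [Algebra K S] (f : K[X]) (x₁ x₂ : S) : S :=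
  2 * ∑ j ∈ Finset.range 5, algebraMap K S (f.coeff (2 * j)) * (x₁ * x₂) ^ j +
    (x₁ + x₂) * ∑ j ∈ Finset.range 4, algebraMap K S (f.coeff (2 * j + 1)) * (x₁ * x₂) ^ j

/-- The polynomial `s₀ = (G(x₁, x₂)² - 4 f(x₁) f(x₂)) / (x₁ - x₂)²`, as a polynomial in `x₂` over
`K[x₁]` (the division is exact). -/
def polyS₀ (f : K[X]) : K[X][X] :=
  (polyG f (C X : K[X][X]) X ^ 2 - 4 * C f * f.map C) /ₘ ((X - C X) ^ 2)

/-- The last coordinate `ξ₈` of the image of `[(P₁) + (P₂) - D_∞]` for `P₁ = (x₁, y₁)` and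
`P₂ = (x₂, y₂)`. It is a root of `s₂ ξ² + s₁ ξ + s₀` with `s₂ = (x₁ - x₂)²`, `s₁ = 2 G(x₁, x₂)` and
`s₀` as above; for `x₁ = x₂` one has `s₂ = 0` and `ξ₈ = - s₀ / s₁`. -/
def xi₈ (f : K[X]) (x₁ y₁ x₂ y₂ : K) : K :=
  open Classical in
  if x₁ = x₂ then - (polyS₀ f).evalEval x₁ x₁ / (2 * polyG f x₁ x₁)
  else (2 * y₁ * y₂ - polyG f x₁ x₂) / (x₁ - x₂) ^ 2

/-- Projective coordinates of the image of `[(P₁) + (P₂) - D_∞]`, where `(P₁) + (P₂)` is in general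
position. (So two points at infinity in this divisor have to be equal, and not Weierstrass
points: then `f₈ ≠ 0`.) -/
def kummerCoordsTwo {f : K[X]} : Pt f → Pt f → Fin 8 → K
  | .affine x₁ y₁ _, .affine x₂ y₂ _ =>
      ![0, 1, -(x₁ + x₂), x₁ * x₂, x₁ ^ 2 + x₁ * x₂ + x₂ ^ 2, -((x₁ + x₂) * (x₁ * x₂)),
        (x₁ * x₂) ^ 2, xi₈ f x₁ y₁ x₂ y₂]
  | .affine x₁ y₁ _, .infinity w _ =>
      ![0, 0, 0, 0, 1, -x₁, x₁ ^ 2,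
        2 * y₁ * w - 2 * f.coeff 8 * x₁ ^ 4 - f.coeff 7 * x₁ ^ 3]
  | .infinity w _, .affine x₁ y₁ _ =>
      ![0, 0, 0, 0, 1, -x₁, x₁ ^ 2,
        2 * y₁ * w - 2 * f.coeff 8 * x₁ ^ 4 - f.coeff 7 * x₁ ^ 3]
  | .infinity _ _, .infinity _ _ =>
      ![0, 0, 0, 0, 0, 0, 1, (4 * f.coeff 6 * f.coeff 8 - f.coeff 7 ^ 2) / (4 * f.coeff 8)]

/-- The invariants `c_{ij} = 2 b_i b_j - a_i c_j - a_j c_i` of a triple `(A, B, C)`. -/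
def mumfordInv (T : K[X] × K[X] × K[X]) (i j : ℕ) : K :=
  2 * T.2.1.coeff i * T.2.1.coeff j - T.1.coeff i * T.2.2.coeff j - T.1.coeff j * T.2.2.coeff i

/-- Projective coordinates of the image of a point of degree `4` with Mumford representation
`(A, B, C)`: `ξ₁ = 1`, the `ξ₂, …, ξ₇` are quadratic in the coefficients of `A, B, C`, and
`ξ₁ ξ₈ = ξ₂ ξ₇ - ξ₃ ξ₆ + ξ₄ ξ₅`. -/
def kummerCoordsFour (T : K[X] × K[X] × K[X]) : Fin 8 → K :=
  let ξ₂ := mumfordInv T 2 4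
  let ξ₃ := mumfordInv T 1 4
  let ξ₄ := mumfordInv T 0 4
  let ξ₅ := mumfordInv T 0 4 + mumfordInv T 1 3
  let ξ₆ := mumfordInv T 0 3
  let ξ₇ := mumfordInv T 0 2
  ![1, ξ₂, ξ₃, ξ₄, ξ₅, ξ₆, ξ₇, ξ₂ * ξ₇ - ξ₃ * ξ₆ + ξ₄ * ξ₅]

/-- Projective coordinates of the image of `Q`. (The image does not depend on the choice of the
representations of `Q`; every `Q ≠ 0` has degree `2` or `4`.) -/
def kummerCoords [IsAlgClosed K] {f : K[X]} (Q : jac f) : Fin 8 → K :=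
  open Classical in
  if Q = 0 then ![0, 0, 0, 0, 0, 0, 0, 1]
  else if h : ∃ P : Pt f × Pt f, IsDegTwoRep Q P.1 P.2 then
    kummerCoordsTwo h.choose.1 h.choose.2
  else kummerCoordsFour (Classical.epsilon (IsDegFourRep Q))

theorem kummerCoordsTwo_ne_zero {f : K[X]} (P₁ P₂ : Pt f) : kummerCoordsTwo P₁ P₂ ≠ 0 := by
  intro h
  cases P₁ <;> cases P₂
  · simpa [kummerCoordsTwo] using congrFun h 1
  · simpa [kummerCoordsTwo] using congrFun h 4
  · simpa [kummerCoordsTwo] using congrFun h 4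
  · simpa [kummerCoordsTwo] using congrFun h 6

theorem kummerCoords_ne_zero [IsAlgClosed K] {f : K[X]} (Q : jac f) : kummerCoords Q ≠ 0 := by
  unfold kummerCoords
  split_ifs with h₀ h
  · intro h
    simpa using congrFun h 7
  · exact kummerCoordsTwo_ne_zero _ _
  · intro h
    simpa [kummerCoordsFour] using congrFun h 0

/-- The map `κ` from the Jacobian to `ℙ⁷` whose image is the Kummer variety. -/
def kappa [IsAlgClosed K] (f : K[X]) (Q : jac f) : ℙ K (Fin 8 → K) :=
  Projectivization.mk K (kummerCoords Q) (kummerCoords_ne_zero Q)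

end Curve

/-! ### Rationality over a subfield `k` of the algebraically closed field `K` -/

section Rational

variable {k : Type*} (K : Type*) [Field k] [Field K] [Algebra k K]

/-- The polynomial `f ∈ k[x]` over `K`. -/
abbrev baseChange (f : k[X]) : K[X] := f.map (algebraMap k K)

/-- The point of `ℙ⁷` with coordinates `ξ` in `k`. -/
def ratPoint (ξ : Fin 8 → k) (hξ : ξ ≠ 0) : ℙ K (Fin 8 → K) :=
  Projectivization.mk K (fun i => algebraMap k K (ξ i)) (fun h => hξ (funext fun i =>
    (algebraMap k K).injective (by simpa using congrFun h i)))

variable {K}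

/-- The action of an automorphism of `K / k` on the points of the curve. -/
def Pt.conj {f : k[X]} (σ : K ≃ₐ[k] K) : Pt (baseChange K f) → Pt (baseChange K f)
  | .affine x y h => .affine (σ x) (σ y) (by
      have h' := congrArg σ h
      rw [map_pow] at h'
      rw [h', eval_map_algebraMap, eval_map_algebraMap]
      exact (aeval_algHom_apply (σ : K →ₐ[k] K) x f).symm)
  | .infinity w h => .infinity (σ w) (by
      have h' := congrArg σ h
      rw [map_pow] at h'
      rw [h', coeff_map, AlgEquiv.commutes])

/-- The action of an automorphism of `K / k` on divisors. -/
def divConj {f : k[X]} (σ : K ≃ₐ[k] K) (D : Divisor (baseChange K f)) :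
    Divisor (baseChange K f) :=
  D.mapDomain (Pt.conj σ)

/-- The point `P` is defined over the separable closure of `k` in `K`. -/
def Pt.IsSep (k : Type*) {K : Type*} [Field k] [Field K] [Algebra k K] {f : K[X]} (P : Pt f) :
    Prop :=
  IsSeparable k P.x ∧ IsSeparable k P.y

/-- The set `J(k)` of `k`-rational points of the Jacobian, for `K` an algebraic closure of `k`: the
Galois-invariant divisor classes of degree `0` over the separable closure of `k`. -/
def rationalPoints (K : Type*) [Field K] [Algebra k K] (f : k[X]) : Set (jac (baseChange K f)) :=
  {Q | ∃ E : Divisor (baseChange K f), (Q : Pic (baseChange K f)) = divClass E ∧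
    (∀ P ∈ E.support, P.IsSep k) ∧ ∀ σ : K ≃ₐ[k] K, divClass (divConj σ E) = divClass E}

end Rational

end

end G3Kummer

/-!
The theorem says when the fibre of `κ` above `R` consists of rational points, and the point is that
rationality of a class `Q = [(P₁) + (P₂) - D_∞]` can be read off from its divisor.

The main ingredient is the uniqueness of this divisor, `eq_or_swap_of_linearEquiv`. Suppose that
`(P₁) + (P₂) - (P₃) - (P₄)` is the divisor of a function `φ`, where all points are affine. Then
`φ (x - x₃) (x - x₄)` is regular on the affine curve, with affine divisor
`(P₁) + (P₂) + (ι P₃) + (ι P₄)`, and its poles at infinity are at most those of `x²`, whereas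
those of `y` exceed those of `x³`. So it is a polynomial `r(x)` (`eq_zero_of_order_at_infinity`). Its divisor
contains `P₁`, so it contains `ι P₁`, and if `P₂ ≠ ι P₁`, then `P₁` is `P₃` or `P₄`; divide by
`x - x₁` and treat `P₂` in the same way. The argument is carried out with ideals in the
coordinate rings of the two charts, which are Dedekind domains because the curve is smooth
(`isDedekindDomain_coordRing`); there the order of vanishing at a point is the multiplicity of its
maximal ideal, and `(x - x₀)` is the product of the ideals of `P` and `ι P`
(`pointIdeal_mul_conj`). In particular, a product of functions has the sum of their divisors, so
that the principal divisors are just the divisors of functions (`mem_principalDivisors_iff`).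

The Galois action preserves principal divisors (`divConj_mem_principalDivisors`), so by uniqueness
`Q` is rational if and only if every automorphism fixes or swaps `P₁` and `P₂`. As `κ(Q)` is
rational, `x₁ + x₂` and `x₁ x₂` are in `k`; hence the coordinates of the two points are
separable over `k` (the characteristic is not `2`), and the invariance of the divisor amounts to the
condition on `y₁ + y₂` and the slope (`mem_rationalPoints_iff`). Finally, `x₁ + x₂`, `x₁ x₂` and `ξ₈`
determine `Q` up to sign, and the condition for `-Q` is the same as for `Q`
(`slopeCondition_of_coords_eq`).
-/

namespace G3Kummer

/-! ### The coordinate ring of the curve `y² = g(x)` -/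

section CoordinateRing

variable {K : Type*} [Field K] {g : K[X]}

theorem coordFun_eq (a b : K[X]) :
    coordFun g a b = AdjoinRoot.of _ a + AdjoinRoot.of _ b * AdjoinRoot.root _ := by
  simp [coordFun, AdjoinRoot.mk_C, AdjoinRoot.mk_X]

theorem root_sq : (AdjoinRoot.root ((X : K[X][X]) ^ 2 - C g)) ^ 2 = AdjoinRoot.of _ g := by
  have h := AdjoinRoot.eval₂_root ((X : K[X][X]) ^ 2 - C g)
  rw [eval₂_sub, eval₂_X_pow, eval₂_C] at h
  exact sub_eq_zero.mp h

theorem coordFun_mul (a b c d : K[X]) :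
    coordFun g a b * coordFun g c d = coordFun g (a * c + b * d * g) (a * d + b * c) := by
  simp only [coordFun_eq, map_add, map_mul, ← root_sq]
  ring

theorem monic_sq_sub_C : ((X : K[X][X]) ^ 2 - C g).Monic := monic_X_pow_sub_C _ two_ne_zero

theorem natDegree_sq_sub_C : ((X : K[X][X]) ^ 2 - C g).natDegree = 2 := natDegree_X_pow_sub_C

theorem exists_coordFun (z : CoordRing g) : ∃ a b : K[X], z = coordFun g a b := by
  obtain ⟨p, rfl⟩ := AdjoinRoot.mk_surjective z
  refine ⟨(p %ₘ (X ^ 2 - C g)).coeff 0, (p %ₘ (X ^ 2 - C g)).coeff 1, ?_⟩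
  have hlt := natDegree_modByMonic_lt p (monic_sq_sub_C (g := g)) (fun h => by
    have := natDegree_sq_sub_C (g := g)
    rw [h, natDegree_one] at this
    omega)
  rw [natDegree_sq_sub_C] at hlt
  have h := eq_X_add_C_of_natDegree_le_one (Nat.le_of_lt_succ hlt)
  rw [coordFun, add_comm, ← h, AdjoinRoot.mk_eq_mk, ← modByMonic_eq_zero_iff_dvd monic_sq_sub_C,
    sub_modByMonic, modByMonic_eq_self_iff monic_sq_sub_C |>.mpr
      (degree_modByMonic_lt _ monic_sq_sub_C), sub_self]

theorem coordFun_eq_zero_iff {a b : K[X]} : coordFun g a b = 0 ↔ a = 0 ∧ b = 0 := by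
  refine ⟨fun h => ?_, by rintro ⟨rfl, rfl⟩; simp [coordFun]⟩
  rw [coordFun, AdjoinRoot.mk_eq_zero] at h
  have h0 : (C a + C b * X : K[X][X]) = 0 := by
    refine eq_zero_of_dvd_of_natDegree_lt h ?_
    rw [natDegree_sq_sub_C, add_comm]
    exact natDegree_linear_le.trans_lt one_lt_two
  exact ⟨by simpa using congrArg (coeff · 0) h0, by simpa using congrArg (coeff · 1) h0⟩

theorem coordFun_inj {a b c d : K[X]} : coordFun g a b = coordFun g c d ↔ a = c ∧ b = d := by
  rw [← sub_eq_zero, ← sub_eq_zero (a := a), ← sub_eq_zero (a := b),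
    ← coordFun_eq_zero_iff (g := g)]
  simp only [coordFun_eq, map_sub]
  ring_nf

/-- The affine curve `y² = g(x)` is integral, since a nonconstant squarefree `g` is not a square. -/
theorem isDomain_coordRing (hsep : g.Separable) (hdeg : g.natDegree ≠ 0) :
    IsDomain (CoordRing g) := by
  refine AdjoinRoot.isDomain_of_prime (Irreducible.prime ?_)
  rw [monic_sq_sub_C.irreducible_iff_roots_eq_zero_of_degree_le_three natDegree_sq_sub_C.ge
    (by rw [natDegree_sq_sub_C]; omega), Multiset.eq_zero_iff_forall_notMem]
  intro h hh
  rw [mem_roots monic_sq_sub_C.ne_zero, IsRoot.def, eval_sub, eval_pow, eval_X, eval_C,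
    sub_eq_zero] at hh
  have hu : IsUnit h := hsep.squarefree h ⟨1, by rw [← hh]; ring⟩
  apply hdeg
  rw [← hh]
  exact natDegree_eq_zero_of_isUnit (hu.pow 2)

/-- Evaluation of functions at a point of the affine curve. -/
noncomputable def evalPoint (g : K[X]) (x₀ y₀ : K) (h : y₀ ^ 2 = g.eval x₀) : CoordRing g →+* K :=
  AdjoinRoot.lift (evalRingHom x₀) y₀ (by simp [h])

theorem evalPoint_coordFun {x₀ y₀ : K} (h : y₀ ^ 2 = g.eval x₀) (a b : K[X]) :
    evalPoint g x₀ y₀ h (coordFun g a b) = a.eval x₀ + b.eval x₀ * y₀ := by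
  simp [evalPoint, coordFun_eq]

theorem pointIdeal_eq_span (x₀ y₀ : K) :
    pointIdeal g x₀ y₀ = Ideal.span {AdjoinRoot.of _ (X - C x₀),
      AdjoinRoot.root _ - AdjoinRoot.of _ (C y₀)} := by
  simp [pointIdeal, AdjoinRoot.mk_C, AdjoinRoot.mk_X]

theorem of_sub_mem_pointIdeal (x₀ y₀ : K) :
    AdjoinRoot.of _ (X - C x₀) ∈ pointIdeal g x₀ y₀ := by
  rw [pointIdeal_eq_span]
  exact Ideal.subset_span (by simp)

theorem root_sub_mem_pointIdeal (x₀ y₀ : K) :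
    AdjoinRoot.root _ - AdjoinRoot.of _ (C y₀) ∈ pointIdeal g x₀ y₀ := by
  rw [pointIdeal_eq_span]
  exact Ideal.subset_span (by simp)

theorem pointIdeal_eq_ker {x₀ y₀ : K} (h : y₀ ^ 2 = g.eval x₀) :
    pointIdeal g x₀ y₀ = RingHom.ker (evalPoint g x₀ y₀ h) := by
  apply le_antisymm
  · rw [pointIdeal_eq_span, Ideal.span_le]
    rintro z (rfl | rfl) <;> simp [evalPoint]
  · intro z hz
    obtain ⟨a, b, rfl⟩ := exists_coordFun z
    rw [RingHom.mem_ker, evalPoint_coordFun] at hz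
    have hroot : (X - C x₀) ∣ a + b * C y₀ := by
      rw [dvd_iff_isRoot]
      simpa using hz
    obtain ⟨q, hq⟩ := hroot
    have : coordFun g a b = AdjoinRoot.of _ q * AdjoinRoot.of _ (X - C x₀) +
        AdjoinRoot.of _ b * (AdjoinRoot.root _ - AdjoinRoot.of _ (C y₀)) := by
      have h1 : a = (X - C x₀) * q - b * C y₀ := by rw [← hq]; ring
      rw [coordFun_eq, h1, map_sub, map_mul, map_mul]
      ring
    rw [this]
    exact add_mem (Ideal.mul_mem_left _ _ (of_sub_mem_pointIdeal _ _))
      (Ideal.mul_mem_left _ _ (root_sub_mem_pointIdeal _ _))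

theorem coordFun_mem_pointIdeal {x₀ y₀ : K} (h : y₀ ^ 2 = g.eval x₀) {a b : K[X]} :
    coordFun g a b ∈ pointIdeal g x₀ y₀ ↔ a.eval x₀ + b.eval x₀ * y₀ = 0 := by
  rw [pointIdeal_eq_ker h, RingHom.mem_ker, evalPoint_coordFun]

theorem of_mem_pointIdeal {x₀ y₀ : K} (h : y₀ ^ 2 = g.eval x₀) {a : K[X]} :
    AdjoinRoot.of _ a ∈ pointIdeal g x₀ y₀ ↔ a.eval x₀ = 0 := by
  simpa [coordFun_eq] using coordFun_mem_pointIdeal h (a := a) (b := 0)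

theorem pointIdeal_isMaximal {x₀ y₀ : K} (h : y₀ ^ 2 = g.eval x₀) :
    (pointIdeal g x₀ y₀).IsMaximal := by
  rw [pointIdeal_eq_ker h]
  exact RingHom.ker_isMaximal_of_surjective _ fun c => ⟨coordFun g (C c) 0, by
    simp [evalPoint_coordFun]⟩

theorem pointIdeal_ne_bot (x₀ y₀ : K) : pointIdeal g x₀ y₀ ≠ ⊥ := by
  intro h
  have h1 := of_sub_mem_pointIdeal (g := g) x₀ y₀
  rw [h, Ideal.mem_bot] at h1
  have h2 : coordFun g (X - C x₀) 0 = 0 := by simpa [coordFun_eq] using h1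
  exact X_sub_C_ne_zero x₀ (coordFun_eq_zero_iff.mp h2).1

theorem pointIdeal_injective {x₀ y₀ x₁ y₁ : K} (h : y₀ ^ 2 = g.eval x₀)
    (he : pointIdeal g x₀ y₀ = pointIdeal g x₁ y₁) : x₀ = x₁ ∧ y₀ = y₁ := by
  have hx : coordFun g (X - C x₁) 0 ∈ pointIdeal g x₀ y₀ := by
    rw [he]
    simpa [coordFun_eq] using of_sub_mem_pointIdeal (g := g) x₁ y₁
  have hy : coordFun g (-C y₁) 1 ∈ pointIdeal g x₀ y₀ := by
    rw [he]
    convert root_sub_mem_pointIdeal (g := g) x₁ y₁ using 1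
    rw [coordFun_eq, map_neg, map_one]
    ring
  rw [coordFun_mem_pointIdeal h] at hx hy
  simp only [eval_sub, eval_X, eval_C, eval_zero, zero_mul, add_zero, eval_neg, eval_one,
    one_mul] at hx hy
  exact ⟨sub_eq_zero.mp hx, by linear_combination hy⟩

/-- The expansion `y² - y₀² = (x - x₀) h(x)` on the curve, with `h(x₀) = g'(x₀)`. -/
theorem exists_expansion {x₀ y₀ : K} (h : y₀ ^ 2 = g.eval x₀) :
    ∃ q : K[X], q.eval x₀ = (derivative g).eval x₀ ∧
      (AdjoinRoot.root ((X : K[X][X]) ^ 2 - C g) - AdjoinRoot.of _ (C y₀)) *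
        (AdjoinRoot.root _ + AdjoinRoot.of _ (C y₀)) =
        AdjoinRoot.of _ (X - C x₀) * AdjoinRoot.of _ q := by
  obtain ⟨q, hq⟩ : X - C x₀ ∣ g - C (y₀ ^ 2) := by
    rw [dvd_iff_isRoot]
    simp [h]
  refine ⟨q, ?_, ?_⟩
  · have := congrArg (fun p => eval x₀ (derivative p)) hq
    simpa [← C_pow, -map_pow] using this.symm
  · rw [← map_mul, ← hq, map_sub, ← root_sq, C_pow, map_pow]
    ring

/-- The divisor of the function `x - x₀` on the affine curve is `(P) + (ι P)`, for `P` a point above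
`x₀`; at Weierstrass points this uses that `g` has only simple roots. -/
theorem pointIdeal_mul_conj (h2 : (2 : K) ≠ 0) (hsep : g.Separable) {x₀ y₀ : K}
    (h : y₀ ^ 2 = g.eval x₀) :
    pointIdeal g x₀ y₀ * pointIdeal g x₀ (-y₀) = Ideal.span {AdjoinRoot.of _ (X - C x₀)} := by
  obtain ⟨q, hq, hexp⟩ := exists_expansion h
  apply le_antisymm
  · rw [pointIdeal_eq_span, pointIdeal_eq_span, Ideal.span_pair_mul_span_pair, Ideal.span_le]
    rintro z (rfl | rfl | rfl | rfl) <;> rw [SetLike.mem_coe, Ideal.mem_span_singleton]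
    · exact Dvd.intro _ rfl
    · exact Dvd.intro _ rfl
    · exact Dvd.intro_left _ rfl
    · rw [C_neg, map_neg, sub_neg_eq_add, hexp]
      exact Dvd.intro _ rfl
  · rw [Ideal.span_singleton_le_iff_mem]
    have hx := of_sub_mem_pointIdeal (g := g) x₀ y₀
    have hx' := of_sub_mem_pointIdeal (g := g) x₀ (-y₀)
    have hy := root_sub_mem_pointIdeal (g := g) x₀ y₀
    have hy' := root_sub_mem_pointIdeal (g := g) x₀ (-y₀)
    have hC : ∀ c : K, c ≠ 0 → AdjoinRoot.of ((X : K[X][X]) ^ 2 - C g) (C c⁻¹) *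
        AdjoinRoot.of _ (C c) = 1 := fun c hc => by
      rw [← map_mul, ← C_mul, inv_mul_cancel₀ hc, C_1, map_one]
    by_cases hy0 : y₀ = 0
    · have hq0 : q.eval x₀ ≠ 0 := by
        rw [hq]
        exact hsep.eval₂_derivative_ne_zero (RingHom.id K) (by rw [← eval, ← h, hy0]; simp)
      obtain ⟨r, hr⟩ : X - C x₀ ∣ q - C (q.eval x₀) := by
        rw [dvd_iff_isRoot]
        simp
      have h3 := Ideal.mul_mem_left _ (AdjoinRoot.of _ (C (q.eval x₀)⁻¹))
        (sub_mem (Ideal.mul_mem_mul hy hy')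
          (Ideal.mul_mem_left _ (AdjoinRoot.of _ r) (Ideal.mul_mem_mul hx hx')))
      convert h3 using 1
      rw [C_neg, map_neg, sub_neg_eq_add, hexp, show q = C (q.eval x₀) + (X - C x₀) * r by
        rw [← hr]; ring, map_add, map_mul]
      simp only [eval_add, eval_C, eval_mul, eval_sub, eval_X, sub_self, zero_mul, add_zero]
      linear_combination (-AdjoinRoot.of _ (X - C x₀)) * hC _ hq0
    · have h3 := Ideal.mul_mem_left _ (AdjoinRoot.of _ (C (2 * y₀)⁻¹))
        (sub_mem (Ideal.mul_mem_mul hx hy') (Ideal.mul_mem_mul hy hx'))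
      convert h3 using 1
      have := hC (2 * y₀) (mul_ne_zero h2 hy0)
      rw [C_mul, map_mul, ← map_ofNat C 2 |>.symm, map_ofNat] at this
      rw [C_neg, map_neg]
      linear_combination (-AdjoinRoot.of _ (X - C x₀)) * this

variable [IsAlgClosed K]

/-- A form of the Nullstellensatz: the nonzero primes of the coordinate ring are the ideals of the
points of the affine curve. -/
theorem exists_eq_pointIdeal {p : Ideal (CoordRing g)} [IsDomain (CoordRing g)] (hp : p.IsPrime)
    (hbot : p ≠ ⊥) : ∃ x₀ y₀ : K, y₀ ^ 2 = g.eval x₀ ∧ p = pointIdeal g x₀ y₀ := by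
  obtain ⟨z, hz, hz0⟩ := Submodule.exists_mem_ne_zero_of_ne_bot hbot
  obtain ⟨a, b, rfl⟩ := exists_coordFun z
  -- the norm of a nonzero function in `p` is a nonzero polynomial in `p`
  have hconj : coordFun g a (-b) ≠ 0 := by
    rw [Ne, coordFun_eq_zero_iff] at hz0 ⊢
    simpa using hz0
  have hN : coordFun g a b * coordFun g a (-b) = AdjoinRoot.of _ (a ^ 2 - b ^ 2 * g) := by
    rw [coordFun_mul, coordFun_eq, show a * -b + b * a = 0 by ring, map_zero, zero_mul, add_zero]
    congr 1
    ring
  have hNmem : AdjoinRoot.of _ (a ^ 2 - b ^ 2 * g) ∈ p := hN ▸ Ideal.mul_mem_right _ _ hz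
  have hN0 : a ^ 2 - b ^ 2 * g ≠ 0 := by
    intro h0
    rw [h0, map_zero] at hN
    exact mul_ne_zero hz0 hconj hN
  -- hence `p` contains some `x - x₀`
  obtain ⟨x₀, hx₀⟩ : ∃ x₀ : K, AdjoinRoot.of _ (X - C x₀) ∈ p := by
    have hq := (Ideal.IsPrime.comap (AdjoinRoot.of ((X : K[X][X]) ^ 2 - C g)) (K := p))
    have hfac := IsAlgClosed.splits (a ^ 2 - b ^ 2 * g)
    have hmem : a ^ 2 - b ^ 2 * g ∈ p.comap (AdjoinRoot.of ((X : K[X][X]) ^ 2 - C g)) := hNmem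
    rw [hfac.eq_prod_roots] at hmem
    rcases hq.mem_or_mem hmem with h | h
    · exfalso
      refine hq.ne_top (Ideal.eq_top_of_isUnit_mem _ h ?_)
      exact isUnit_C.mpr (leadingCoeff_ne_zero.mpr hN0).isUnit
    · rw [hq.multiset_prod_mem_iff_exists_mem] at h
      obtain ⟨l, hl, hlp⟩ := h
      obtain ⟨x₀, -, rfl⟩ := Multiset.mem_map.mp hl
      exact ⟨x₀, hlp⟩
  obtain ⟨y₀, hy₀⟩ := IsAlgClosed.exists_pow_nat_eq (g.eval x₀) (n := 2) two_pos
  obtain ⟨q, -, hexp⟩ := exists_expansion hy₀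
  have hmem := Ideal.mul_mem_right (AdjoinRoot.of _ q) _ hx₀
  rw [← hexp] at hmem
  have key : ∀ y₁ : K, y₁ ^ 2 = g.eval x₀ →
      AdjoinRoot.root _ - AdjoinRoot.of _ (C y₁) ∈ p →
      ∃ x₀ y₀ : K, y₀ ^ 2 = g.eval x₀ ∧ p = pointIdeal g x₀ y₀ := fun y₁ h₁ hm =>
    ⟨x₀, y₁, h₁, ((pointIdeal_isMaximal h₁).eq_of_le hp.ne_top (by
      rw [pointIdeal_eq_span, Ideal.span_le]
      rintro z (rfl | rfl)
      · exact hx₀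
      · exact hm)).symm⟩
  rcases hp.mem_or_mem hmem with h | h
  · exact key y₀ hy₀ h
  · exact key (-y₀) (by rw [neg_sq, hy₀]) (by rwa [C_neg, map_neg, sub_neg_eq_add])

/-- The curve `y² = g(x)` is smooth if `g` has only simple roots: `x - x₀` or `y - y₀` is a
local parameter at `(x₀, y₀)`, according as `y₀ ≠ 0` or `y₀ = 0`. -/
theorem isDedekindDomain_coordRing (h2 : (2 : K) ≠ 0) (hsep : g.Separable)
    (hdeg : g.natDegree ≠ 0) : IsDedekindDomain (CoordRing g) := by
  have := isDomain_coordRing hsep hdeg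
  suffices IsDedekindDomainDvr (CoordRing g) from inferInstance
  refine { isNoetherian_iff'.mpr inferInstance with is_dvr_at_nonzero_prime := ?_ }
  intro p hbot hp
  have hfield : ¬ IsField (Localization.AtPrime p) :=
    IsLocalization.AtPrime.not_isField (CoordRing g) hbot _
  have : IsNoetherianRing (Localization.AtPrime p) :=
    IsLocalization.isNoetherianRing p.primeCompl _ inferInstance
  refine ((IsDiscreteValuationRing.TFAE _ hfield).out 0 4).mpr ?_
  obtain ⟨x₀, y₀, h, rfl⟩ := exists_eq_pointIdeal hp hbot
  obtain ⟨q, hq, hexp⟩ := exists_expansion h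
  have hunit : ∀ z, z ∉ pointIdeal g x₀ y₀ →
      IsUnit (algebraMap _ (Localization.AtPrime (pointIdeal g x₀ y₀)) z) := fun z hz =>
    IsLocalization.map_units (M := (pointIdeal g x₀ y₀).primeCompl) _ ⟨z, hz⟩
  have hexp' := congrArg (algebraMap _ (Localization.AtPrime (pointIdeal g x₀ y₀))) hexp
  rw [map_mul, map_mul] at hexp'
  have hspan := congrArg (Ideal.map (algebraMap _ (Localization.AtPrime (pointIdeal g x₀ y₀))))
    (pointIdeal_eq_span (g := g) x₀ y₀)
  rw [Ideal.map_span, Set.image_pair] at hspan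
  rw [← Localization.AtPrime.map_eq_maximalIdeal, hspan]
  by_cases hy0 : y₀ = 0
  · have hu := hunit (AdjoinRoot.of _ q) (by
      rw [of_mem_pointIdeal h, hq]
      exact hsep.eval₂_derivative_ne_zero (RingHom.id K) (by rw [← eval, ← h, hy0]; simp))
    rw [Ideal.span_pair_eq_span_right_iff_dvd.mpr (hu.dvd_mul_right.mp (Dvd.intro _ hexp'))]
    exact ⟨⟨_, rfl⟩⟩
  · have hu := hunit (AdjoinRoot.root _ + AdjoinRoot.of _ (C y₀)) (by
      have := coordFun_mem_pointIdeal h (a := C y₀) (b := 1)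
      rw [coordFun_eq, map_one, one_mul, add_comm] at this
      rw [this, eval_C, eval_one, one_mul, ← two_mul]
      exact mul_ne_zero h2 hy0)
    rw [Ideal.span_pair_eq_span_left_iff_dvd.mpr (hu.dvd_mul_right.mp (Dvd.intro _ hexp'.symm))]
    exact ⟨⟨_, rfl⟩⟩

end CoordinateRing

/-! ### Orders of vanishing and principal divisors -/

section PrincipalDivisors

variable {K : Type*} [Field K] {f : K[X]}

theorem X_mul_derivative_reflect {n : ℕ} (hdeg : f.natDegree ≤ n) :
    X * derivative (f.reflect n) = C (n : K) * f.reflect n - (X * derivative f).reflect n := by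
  have hX : ∀ (p : K[X]) (i : ℕ), (X * derivative p).coeff i = i * p.coeff i := by
    intro p i
    cases i with
    | zero => simp
    | succ i => rw [coeff_X_mul, coeff_derivative]; push_cast; ring
  ext i
  rw [hX, coeff_sub, coeff_C_mul, coeff_reflect, coeff_reflect, hX]
  by_cases hi : i ≤ n
  · rw [revAt_le hi, Nat.cast_sub hi]
    ring
  · rw [revAt_eq_self_of_lt (not_le.mp hi), coeff_eq_zero_of_natDegree_lt (by omega)]
    simp

/-- The reversed polynomial `F(1, u)` has no multiple roots either, also at `u = 0`. -/
theorem separable_reflect [IsAlgClosed K] (hsep : f.Separable) (hdeg : f.natDegree = 7 ∨ f.natDegree = 8) :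
    (f.reflect 8).Separable := by
  have hle : f.natDegree ≤ 8 := by omega
  rw [separable_def]
  by_contra hcop
  obtain ⟨u, hu, hu'⟩ : ∃ u : K, (f.reflect 8).eval u = 0 ∧ (derivative (f.reflect 8)).eval u = 0 := by
    by_contra! h
    refine hcop (isCoprime_of_dvd _ _ ?_ ?_)
    · rintro ⟨h0, -⟩
      rw [reflect_eq_zero_iff] at h0
      simp [h0] at hdeg
    · intro z hz hz0 hzf hzf'
      obtain ⟨u, hu⟩ := IsAlgClosed.exists_root z (fun hd => hz
        (isUnit_iff_degree_eq_zero.mpr hd))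
      exact h u (hu.dvd hzf) (hu.dvd hzf')
  by_cases hu0 : u = 0
  · -- at `u = 0` the value and the derivative are `f₈` and `f₇`
    subst hu0
    rw [← coeff_zero_eq_eval_zero] at hu hu'
    rw [coeff_derivative] at hu'
    rw [coeff_reflect] at hu hu'
    norm_num [revAt_le] at hu hu'
    have hf0 : f ≠ 0 := by rintro rfl; simp at hdeg
    rcases hdeg with h | h
    · exact leadingCoeff_ne_zero.mpr hf0 (by rw [leadingCoeff, h]; exact hu')
    · exact leadingCoeff_ne_zero.mpr hf0 (by rw [leadingCoeff, h]; exact hu)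
  · have hinv := invertibleOfNonzero (inv_ne_zero hu0)
    have heval : ∀ p : K[X], p.natDegree ≤ 8 →
        ((p.reflect 8).eval u = 0 ↔ p.eval u⁻¹ = 0) := by
      intro p hp
      have := eval₂_reflect_eq_zero_iff (RingHom.id K) u⁻¹ 8 p hp
      rwa [invOf_eq_inv, inv_inv] at this
    have h1 := congrArg (eval u) (X_mul_derivative_reflect hle)
    rw [eval_mul, hu', eval_sub, eval_mul, hu, mul_zero, mul_zero, zero_sub, eq_comm,
      neg_eq_zero, heval _ ?_, eval_mul, eval_X, mul_eq_zero, or_iff_right (inv_ne_zero hu0)] at h1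
    · exact hsep.eval₂_derivative_ne_zero (RingHom.id K) ((heval f hle).mp hu) h1
    · have := natDegree_derivative_lt (p := f) (by omega)
      exact natDegree_mul_le.trans (by rw [natDegree_X]; omega)

theorem natDegree_reflect_ne_zero (hsep : f.Separable) : (f.reflect 8).natDegree ≠ 0 := by
  intro h
  have h0 := coeff_eq_zero_of_natDegree_lt (p := f.reflect 8) (n := 8) (by omega)
  have h1 := coeff_eq_zero_of_natDegree_lt (p := f.reflect 8) (n := 7) (by omega)
  rw [coeff_reflect] at h0 h1
  norm_num [revAt_le] at h0 h1
  refine hsep.eval₂_derivative_ne_zero (RingHom.id K) (x := 0) ?_ ?_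
  · rw [← eval, ← coeff_zero_eq_eval_zero, h0]
  · rw [← eval, ← coeff_zero_eq_eval_zero, coeff_derivative, h1, zero_mul]

theorem curve_infinity {w : K} (h : w ^ 2 = f.coeff 8) : w ^ 2 = (f.reflect 8).eval 0 := by
  rw [h, ← coeff_zero_eq_eval_zero, coeff_reflect]
  norm_num [revAt_le]

namespace CurveForm

/-- The restriction of a form to the chart `z ≠ 0`. -/
noncomputable def affineFun {e : ℕ} (f : K[X]) (G : CurveForm K e) : CoordRing f :=
  coordFun f G.a G.b

/-- The restriction of a form to the chart `x ≠ 0`. -/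
noncomputable def infinityFun {e : ℕ} (f : K[X]) (G : CurveForm K e) : CoordRing (f.reflect 8) :=
  coordFun (f.reflect 8) (G.a.reflect (e + 4)) (G.b.reflect e)

theorem affineFun_ne_zero {e : ℕ} (G : CurveForm K e) : G.affineFun f ≠ 0 := by
  rw [affineFun, Ne, coordFun_eq_zero_iff, not_and_or]
  exact G.ne_zero

theorem infinityFun_ne_zero {e : ℕ} (G : CurveForm K e) : G.infinityFun f ≠ 0 := by
  rw [infinityFun, Ne, coordFun_eq_zero_iff, not_and_or, reflect_eq_zero_iff, reflect_eq_zero_iff]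
  exact G.ne_zero

/-- The product of two forms on the curve, reduced modulo the equation `y² = F(x, z)`. -/
noncomputable def mul {e e' : ℕ} (hsep : f.Separable) (hdeg : f.natDegree = 7 ∨ f.natDegree = 8)
    (G : CurveForm K e) (H : CurveForm K e') : CurveForm K (e + e' + 4) where
  a := G.a * H.a + G.b * H.b * f
  b := G.a * H.b + G.b * H.a
  natDegree_a := by
    have h1 := natDegree_mul_le_of_le G.natDegree_a H.natDegree_a
    have h2 := natDegree_mul_le_of_le (natDegree_mul_le_of_le G.natDegree_b H.natDegree_b)
      (show f.natDegree ≤ 8 by omega)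
    exact natDegree_add_le_of_degree_le (by omega) (by omega)
  natDegree_b := by
    have h1 := natDegree_mul_le_of_le G.natDegree_a H.natDegree_b
    have h2 := natDegree_mul_le_of_le G.natDegree_b H.natDegree_a
    exact natDegree_add_le_of_degree_le (by omega) (by omega)
  ne_zero := by
    have := isDomain_coordRing hsep (by omega)
    rw [← not_and_or, ← coordFun_eq_zero_iff (g := f), ← coordFun_mul]
    exact mul_ne_zero G.affineFun_ne_zero H.affineFun_ne_zero

theorem affineFun_mul {e e' : ℕ} (hsep : f.Separable) (hdeg : f.natDegree = 7 ∨ f.natDegree = 8)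
    (G : CurveForm K e) (H : CurveForm K e') :
    (mul hsep hdeg G H).affineFun f = G.affineFun f * H.affineFun f :=
  (coordFun_mul _ _ _ _).symm

theorem infinityFun_mul {e e' : ℕ} (hsep : f.Separable) (hdeg : f.natDegree = 7 ∨ f.natDegree = 8)
    (G : CurveForm K e) (H : CurveForm K e') :
    (mul hsep hdeg G H).infinityFun f = G.infinityFun f * H.infinityFun f := by
  rw [infinityFun, infinityFun, infinityFun, coordFun_mul,
    ← reflect_mul _ _ G.natDegree_a H.natDegree_a, ← reflect_mul _ _ G.natDegree_b H.natDegree_b,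
    ← reflect_mul _ _ G.natDegree_a H.natDegree_b, ← reflect_mul _ _ G.natDegree_b H.natDegree_a,
    ← reflect_mul _ _ (natDegree_mul_le_of_le G.natDegree_b H.natDegree_b)
      (show f.natDegree ≤ 8 by omega),
    show e + 4 + (e' + 4) = e + e' + 4 + 4 by ring, show e + e' + 8 = e + e' + 4 + 4 by ring,
    show e + 4 + e' = e + e' + 4 by ring, show e + (e' + 4) = e + e' + 4 by ring,
    ← reflect_add, ← reflect_add]
  rfl

end CurveForm

section Order

variable {g : K[X]}

theorem mem_pow_and_notMem_pow_iff [IsDedekindDomain (CoordRing g)] {I : Ideal (CoordRing g)}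
    {z : CoordRing g} {n : ℕ} :
    z ∈ I ^ n ∧ z ∉ I ^ (n + 1) ↔ emultiplicity I (Ideal.span {z}) = n := by
  rw [emultiplicity_eq_coe, Ideal.dvd_span_singleton, Ideal.dvd_span_singleton]

theorem pointIdeal_prime [IsDedekindDomain (CoordRing g)] {x₀ y₀ : K}
    (h : y₀ ^ 2 = g.eval x₀) : Prime (pointIdeal g x₀ y₀) :=
  Ideal.prime_of_isPrime (pointIdeal_ne_bot _ _) (pointIdeal_isMaximal h).isPrime

end Order

theorem hasOrderAt_affine [IsDedekindDomain (CoordRing f)] {e n : ℕ} {G : CurveForm K e} {x y : K}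
    (h : y ^ 2 = f.eval x) :
    HasOrderAt G n (Pt.affine x y h) ↔
      emultiplicity (pointIdeal f x y) (Ideal.span {G.affineFun f}) = n :=
  mem_pow_and_notMem_pow_iff

theorem hasOrderAt_infinity [IsDedekindDomain (CoordRing (f.reflect 8))] {e n : ℕ}
    {G : CurveForm K e} {w : K} (h : w ^ 2 = f.coeff 8) :
    HasOrderAt G n (Pt.infinity w h) ↔
      emultiplicity (pointIdeal (f.reflect 8) 0 w) (Ideal.span {G.infinityFun f}) = n :=
  mem_pow_and_notMem_pow_iff

section

variable [IsAlgClosed K] (h2 : (2 : K) ≠ 0) (hsep : f.Separable) (hdeg : f.natDegree = 7 ∨ f.natDegree = 8)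
include h2 hsep hdeg

theorem isDedekindDomain_affine : IsDedekindDomain (CoordRing f) :=
  isDedekindDomain_coordRing h2 hsep (by omega)

theorem isDedekindDomain_infinity : IsDedekindDomain (CoordRing (f.reflect 8)) :=
  isDedekindDomain_coordRing h2 (separable_reflect hsep hdeg) (natDegree_reflect_ne_zero hsep)

theorem exists_hasOrderAt {e : ℕ} (G : CurveForm K e) (P : Pt f) : ∃ n, HasOrderAt G n P := by
  have := isDedekindDomain_affine h2 hsep hdeg
  have := isDedekindDomain_infinity h2 hsep hdeg
  cases P with
  | affine x y h =>
    have hfin := FiniteMultiplicity.of_prime_left (pointIdeal_prime h)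
      (Ideal.span_singleton_eq_bot.not.mpr (G.affineFun_ne_zero (f := f)))
    exact ⟨_, (hasOrderAt_affine h).mpr hfin.emultiplicity_eq_multiplicity⟩
  | infinity w h =>
    have hfin := FiniteMultiplicity.of_prime_left (pointIdeal_prime (curve_infinity h))
      (Ideal.span_singleton_eq_bot.not.mpr
        (G.infinityFun_ne_zero (f := f)))
    exact ⟨_, (hasOrderAt_infinity h).mpr hfin.emultiplicity_eq_multiplicity⟩

theorem HasOrderAt.mul {e e' m n : ℕ} {G : CurveForm K e} {H : CurveForm K e'} {P : Pt f}
    (hG : HasOrderAt G m P) (hH : HasOrderAt H n P) :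
    HasOrderAt (CurveForm.mul hsep hdeg G H) (m + n) P := by
  have := isDedekindDomain_affine h2 hsep hdeg
  have := isDedekindDomain_infinity h2 hsep hdeg
  cases P with
  | affine x y h =>
    rw [hasOrderAt_affine] at hG hH ⊢
    rw [CurveForm.affineFun_mul, ← Ideal.span_singleton_mul_span_singleton,
      emultiplicity_mul (pointIdeal_prime h), hG, hH, Nat.cast_add]
  | infinity w h =>
    rw [hasOrderAt_infinity] at hG hH ⊢
    rw [CurveForm.infinityFun_mul, ← Ideal.span_singleton_mul_span_singleton,
      emultiplicity_mul (pointIdeal_prime (curve_infinity h)), hG, hH, Nat.cast_add]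

/-- The divisors of rational functions form a group. -/
theorem mem_principalDivisors_iff {D : Divisor f} : D ∈ principalDivisors f ↔ IsPrincipal D := by
  refine ⟨fun h => ?_, fun h => AddSubgroup.subset_closure h⟩
  induction h using AddSubgroup.closure_induction with
  | mem D h => exact h
  | zero =>
    have G : CurveForm K 0 := ⟨1, 0, by simp, by simp, by simp⟩
    refine ⟨0, G, G, fun P => ?_⟩
    obtain ⟨n, hn⟩ := exists_hasOrderAt h2 hsep hdeg G P
    exact ⟨n, n, hn, hn, by simp⟩
  | add D D' _ _ h h' =>
    obtain ⟨e, G, H, hD⟩ := h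
    obtain ⟨e', G', H', hD'⟩ := h'
    refine ⟨_, CurveForm.mul hsep hdeg G G', CurveForm.mul hsep hdeg H H', fun P => ?_⟩
    obtain ⟨m, n, hm, hn, h⟩ := hD P
    obtain ⟨m', n', hm', hn', h'⟩ := hD' P
    refine ⟨m + m', n + n', hm.mul h2 hsep hdeg hm', hn.mul h2 hsep hdeg hn', ?_⟩
    rw [Finsupp.add_apply, h, h']
    push_cast
    ring
  | neg D _ h =>
    obtain ⟨e, G, H, hD⟩ := h
    refine ⟨e, H, G, fun P => ?_⟩
    obtain ⟨m, n, hm, hn, h⟩ := hD P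
    exact ⟨n, m, hn, hm, by rw [Finsupp.neg_apply, h]; ring⟩

end

end PrincipalDivisors

/-! ### Uniqueness of divisors of degree two in general position -/

section Uniqueness

variable {K : Type*} [Field K] {f : K[X]}

open Classical in
theorem emultiplicity_pointIdeal [IsDedekindDomain (CoordRing f)] {x y x' y' : K}
    (h : y ^ 2 = f.eval x) (h' : y' ^ 2 = f.eval x') :
    emultiplicity (pointIdeal f x y) (pointIdeal f x' y') =
      ((if Pt.affine x' y' h' = Pt.affine x y h then 1 else 0 : ℕ) : ℕ∞) := by
  split_ifs with hP
  · obtain ⟨rfl, rfl⟩ := Pt.affine.inj hP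
    rw [Nat.cast_one]
    exact (FiniteMultiplicity.of_prime_left (pointIdeal_prime h)
      (pointIdeal_ne_bot _ _)).emultiplicity_self
  · rw [Nat.cast_zero, emultiplicity_eq_zero, Ideal.dvd_iff_le]
    intro hle
    obtain ⟨rfl, rfl⟩ := pointIdeal_injective h'
      ((pointIdeal_isMaximal h').eq_of_le (pointIdeal_isMaximal h).ne_top hle)
    exact hP rfl

theorem eq_of_pointIdeal_dvd [IsDedekindDomain (CoordRing f)] {x y x' y' : K}
    (h : y ^ 2 = f.eval x) (h' : y' ^ 2 = f.eval x')
    (hdvd : pointIdeal f x y ∣ pointIdeal f x' y') : x' = x ∧ y' = y :=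
  pointIdeal_injective h' ((pointIdeal_isMaximal h').eq_of_le (pointIdeal_isMaximal h).ne_top
    (Ideal.dvd_iff_le.mp hdvd))

/-- If a polynomial in `x` has affine divisor `(P) + D`, it is divisible by `x - x(P)`, and the
quotient has divisor `D - (ι P)`; in particular, `D` contains `ι P`. -/
theorem exists_of_span_eq_mul [IsDedekindDomain (CoordRing f)] (h2 : (2 : K) ≠ 0)
    (hsep : f.Separable) {x y : K} (h : y ^ 2 = f.eval x)
    {r : K[X]} {J : Ideal (CoordRing f)}
    (hr : Ideal.span {AdjoinRoot.of _ r} = pointIdeal f x y * J) :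
    ∃ r', pointIdeal f x (-y) * Ideal.span {AdjoinRoot.of _ r'} = J := by
  have hmem : AdjoinRoot.of _ r ∈ pointIdeal f x y :=
    Ideal.mul_le_left (hr ▸ Ideal.mem_span_singleton_self _)
  rw [of_mem_pointIdeal h] at hmem
  obtain ⟨r', rfl⟩ := dvd_iff_isRoot.mpr hmem
  refine ⟨r', mul_left_cancel₀ (pointIdeal_ne_bot (g := f) x y) ?_⟩
  rw [← hr, map_mul, ← Ideal.span_singleton_mul_span_singleton, ← pointIdeal_mul_conj h2 hsep h,
    mul_assoc]

variable [IsAlgClosed K]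

/-- If two ideals have the same multiplicity at each point of the affine curve, they agree. -/
theorem ideal_eq_of_emultiplicity_eq [IsDedekindDomain (CoordRing f)] {I J : Ideal (CoordRing f)}
    (hI : I ≠ 0) (hJ : J ≠ 0) (h : ∀ x y : K, y ^ 2 = f.eval x →
      emultiplicity (pointIdeal f x y) I = emultiplicity (pointIdeal f x y) J) : I = J := by
  have key : ∀ p : Ideal (CoordRing f), Prime p → emultiplicity p I = emultiplicity p J := by
    intro p hp
    obtain ⟨x, y, hxy, rfl⟩ := exists_eq_pointIdeal (Ideal.isPrime_of_prime hp) hp.ne_zero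
    exact h x y hxy
  apply le_antisymm
  · exact Ideal.dvd_iff_le.mp ((UniqueFactorizationMonoid.dvd_iff_emultiplicity_le hJ).mpr
      fun p hp => (key p hp).ge)
  · exact Ideal.dvd_iff_le.mp ((UniqueFactorizationMonoid.dvd_iff_emultiplicity_le hI).mpr
      fun p hp => (key p hp).le)

variable (h2 : (2 : K) ≠ 0) (hsep : f.Separable) (hdeg : f.natDegree = 7 ∨ f.natDegree = 8)
include h2 hsep hdeg

/-- If the function `r(x) + s(x) y` is `(G / H) l(x)` with `G / H` without zeros and poles at
infinity and `l` of degree at most `2`, then its poles at infinity are at most those of `x²`. As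
those of `y` exceed those of `x³`, this forces `s = 0`. -/
theorem eq_zero_of_order_at_infinity {e : ℕ} (G H : CurveForm K e)
    (hGH : ∀ (w : K) (h : w ^ 2 = f.coeff 8), ∃ n, HasOrderAt G n (Pt.infinity w h) ∧
      HasOrderAt H n (Pt.infinity w h))
    {l r s : K[X]} (hl : l.natDegree ≤ 2) (hl0 : l ≠ 0)
    (heq : G.affineFun f * coordFun f l 0 = H.affineFun f * coordFun f r s) : s = 0 := by
  have := isDedekindDomain_affine h2 hsep hdeg
  have := isDedekindDomain_infinity h2 hsep hdeg
  by_contra hs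
  let N := max r.natDegree s.natDegree
  let R : CurveForm K N := ⟨r, s, (le_max_left _ _).trans (Nat.le_add_right _ _),
    le_max_right _ _, Or.inr hs⟩
  let L : CurveForm K N := ⟨l, 0, by omega, by simp, Or.inl hl0⟩
  have hforms : G.mul hsep hdeg L = H.mul hsep hdeg R := by
    obtain ⟨ha, hb⟩ := coordFun_inj.mp
      ((CurveForm.affineFun_mul hsep hdeg G L).trans
        (heq.trans (CurveForm.affineFun_mul hsep hdeg H R).symm))
    cases hG : G.mul hsep hdeg L
    cases hH : H.mul hsep hdeg R
    rw [hG, hH] at ha hb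
    simp only at ha hb
    subst ha hb
    rfl
  have hinf : G.infinityFun f * L.infinityFun f = H.infinityFun f * R.infinityFun f := by
    rw [← CurveForm.infinityFun_mul hsep hdeg, hforms, CurveForm.infinityFun_mul]
  -- in terms of `u = z / x`, the form `z ^ (N + 2) l(x, z)` is divisible by `u ^ (N + 2)`
  have hL : L.infinityFun f = AdjoinRoot.of _ (X ^ (N + 2)) * AdjoinRoot.of _ (l.reflect 2) := by
    have h1 := reflect_mul (1 : K[X]) l (F := N + 2) (G := 2) (by simp) hl
    rw [one_mul, reflect_one] at h1
    rw [← map_mul, ← h1, CurveForm.infinityFun, coordFun_eq]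
    simp [L]
  have hu0 : AdjoinRoot.of ((X : K[X][X]) ^ 2 - C (f.reflect 8)) (X ^ (N + 2)) ≠ 0 := by
    intro h
    have h' : coordFun (f.reflect 8) (X ^ (N + 2)) 0 = 0 := by simpa [coordFun_eq] using h
    exact pow_ne_zero _ X_ne_zero (coordFun_eq_zero_iff.mp h').1
  have hdvd : Ideal.span {AdjoinRoot.of ((X : K[X][X]) ^ 2 - C (f.reflect 8)) (X ^ (N + 2))} ∣
      Ideal.span {R.infinityFun f} := by
    rw [UniqueFactorizationMonoid.dvd_iff_emultiplicity_le
      (Ideal.span_singleton_eq_bot.not.mpr hu0)]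
    intro p hp
    have hprime := Ideal.isPrime_of_prime hp
    by_cases hup : AdjoinRoot.of ((X : K[X][X]) ^ 2 - C (f.reflect 8)) X ∈ p
    · obtain ⟨x₀, w, hw, rfl⟩ := exists_eq_pointIdeal hprime hp.ne_zero
      rw [of_mem_pointIdeal hw, eval_X] at hup
      subst hup
      have hw' : w ^ 2 = f.coeff 8 := by
        rw [hw, ← coeff_zero_eq_eval_zero, coeff_reflect]
        norm_num [revAt_le]
      obtain ⟨n, hn, hn'⟩ := hGH w hw'
      rw [hasOrderAt_infinity] at hn hn'
      have hm := congrArg (fun z => emultiplicity (pointIdeal (f.reflect 8) 0 w)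
        (Ideal.span {z})) hinf
      simp only [← Ideal.span_singleton_mul_span_singleton, emultiplicity_mul hp, hn, hn'] at hm
      rw [← (ENat.addLECancellable_natCast n).inj.mp hm]
      apply emultiplicity_le_emultiplicity_of_dvd_right
      rw [hL, ← Ideal.span_singleton_mul_span_singleton]
      exact Dvd.intro _ rfl
    · rw [emultiplicity_eq_zero.mpr]
      · exact zero_le
      · rw [Ideal.dvd_span_singleton, map_pow]
        exact fun h => hup (hprime.mem_of_pow_mem _ h)
  rw [Ideal.dvd_span_singleton, Ideal.mem_span_singleton] at hdvd
  obtain ⟨z, hz⟩ := hdvd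
  obtain ⟨r', s', rfl⟩ := exists_coordFun z
  have hz' : R.infinityFun f = coordFun (f.reflect 8) (X ^ (N + 2) * r') (X ^ (N + 2) * s') := by
    rw [hz, coordFun_eq, coordFun_eq, map_mul, map_mul]
    ring
  obtain ⟨-, hs'⟩ := coordFun_inj.mp hz'
  have hdle : (s.reflect N).natDegree ≤ N :=
    natDegree_reflect_le.trans (max_le le_rfl (le_max_right _ _))
  have hs0 : s.reflect N ≠ 0 := reflect_eq_zero_iff.not.mpr hs
  have hs'0 : s' ≠ 0 := by
    rintro rfl
    exact hs0 (by rw [show s.reflect N = _ from hs', mul_zero])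
  rw [show s.reflect N = _ from hs', natDegree_mul (pow_ne_zero _ X_ne_zero) hs'0,
    natDegree_X_pow] at hdle
  omega

/-- A divisor `(P₁) + (P₂)` in general position is the only effective divisor in its class (among
those with affine points, to which the statement is restricted). -/
theorem eq_or_swap_of_linearEquiv {x₁ y₁ x₂ y₂ x₃ y₃ x₄ y₄ : K} (h₁ : y₁ ^ 2 = f.eval x₁)
    (h₂ : y₂ ^ 2 = f.eval x₂) (h₃ : y₃ ^ 2 = f.eval x₃) (h₄ : y₄ ^ 2 = f.eval x₄)
    (hgp : ¬ (x₂ = x₁ ∧ y₂ = -y₁))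
    (hD : Finsupp.single (Pt.affine x₁ y₁ h₁) 1 + Finsupp.single (Pt.affine x₂ y₂ h₂) 1 -
      (Finsupp.single (Pt.affine x₃ y₃ h₃) 1 + Finsupp.single (Pt.affine x₄ y₄ h₄) 1) ∈
        principalDivisors f) :
    ((x₁ = x₃ ∧ y₁ = y₃) ∧ (x₂ = x₄ ∧ y₂ = y₄)) ∨
      ((x₁ = x₄ ∧ y₁ = y₄) ∧ (x₂ = x₃ ∧ y₂ = y₃)) := by
  classical
  have := isDedekindDomain_affine h2 hsep hdeg
  obtain ⟨e, G, H, hGH⟩ := (mem_principalDivisors_iff h2 hsep hdeg).mp hD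
  have hne : ∀ x y, pointIdeal f x y ≠ 0 := pointIdeal_ne_bot
  have hG0 : Ideal.span {G.affineFun f} ≠ 0 :=
    Ideal.span_singleton_eq_bot.not.mpr G.affineFun_ne_zero
  have hH0 : Ideal.span {H.affineFun f} ≠ 0 :=
    Ideal.span_singleton_eq_bot.not.mpr H.affineFun_ne_zero
  have hideal : Ideal.span {G.affineFun f} * (pointIdeal f x₃ y₃ * pointIdeal f x₄ y₄) =
      Ideal.span {H.affineFun f} * (pointIdeal f x₁ y₁ * pointIdeal f x₂ y₂) := by
    refine ideal_eq_of_emultiplicity_eq (mul_ne_zero hG0 (mul_ne_zero (hne _ _) (hne _ _)))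
      (mul_ne_zero hH0 (mul_ne_zero (hne _ _) (hne _ _))) fun x y h => ?_
    obtain ⟨m, n, hm, hn, hmn⟩ := hGH (Pt.affine x y h)
    rw [hasOrderAt_affine] at hm hn
    have hp := pointIdeal_prime h
    simp only [emultiplicity_mul hp, hm, hn, emultiplicity_pointIdeal h h₁,
      emultiplicity_pointIdeal h h₂, emultiplicity_pointIdeal h h₃, emultiplicity_pointIdeal h h₄]
    simp only [Finsupp.sub_apply, Finsupp.add_apply, Finsupp.single_apply] at hmn
    norm_cast
    zify
    linear_combination -hmn
  have hconj : ∀ {x y : K}, y ^ 2 = f.eval x → (-y) ^ 2 = f.eval x := fun h => by rw [neg_sq, h]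
  -- multiply by the ideals of `ι P₃` and `ι P₄`
  have hl : Ideal.span {G.affineFun f * coordFun f ((X - C x₃) * (X - C x₄)) 0} =
      Ideal.span {H.affineFun f} * (pointIdeal f x₁ y₁ *
        (pointIdeal f x₂ y₂ * (pointIdeal f x₃ (-y₃) * pointIdeal f x₄ (-y₄)))) := by
    rw [coordFun_eq, map_zero, zero_mul, add_zero, map_mul, ← Ideal.span_singleton_mul_span_singleton,
      ← Ideal.span_singleton_mul_span_singleton, ← pointIdeal_mul_conj h2 hsep h₃,
      ← pointIdeal_mul_conj h2 hsep h₄]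
    have := congrArg (· * (pointIdeal f x₃ (-y₃) * pointIdeal f x₄ (-y₄))) hideal
    simp only [mul_assoc, mul_comm, mul_left_comm] at this ⊢
    exact this
  have hdvd : H.affineFun f ∣ G.affineFun f * coordFun f ((X - C x₃) * (X - C x₄)) 0 := by
    rw [← Ideal.span_singleton_le_span_singleton, hl]
    exact Ideal.mul_le_left
  obtain ⟨q, hq⟩ := hdvd
  obtain ⟨r, s, rfl⟩ := exists_coordFun q
  have hs : s = 0 := by
    refine eq_zero_of_order_at_infinity h2 hsep hdeg G H (fun w h => ?_)
      (natDegree_mul_le_of_le (natDegree_X_sub_C_le x₃) (natDegree_X_sub_C_le x₄))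
      (mul_ne_zero (X_sub_C_ne_zero _) (X_sub_C_ne_zero _)) hq
    obtain ⟨m, n, hm, hn, hmn⟩ := hGH (Pt.infinity w h)
    simp only [Finsupp.sub_apply, Finsupp.add_apply, Finsupp.single_apply, reduceCtorEq,
      if_false] at hmn
    obtain rfl : m = n := by omega
    exact ⟨m, hm, hn⟩
  subst hs
  rw [hq, ← Ideal.span_singleton_mul_span_singleton] at hl
  have hr := mul_left_cancel₀ hH0 hl
  rw [coordFun_eq, map_zero, zero_mul, add_zero] at hr
  obtain ⟨r₁, hr₁⟩ := exists_of_span_eq_mul h2 hsep h₁ hr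
  have hp := pointIdeal_prime (hconj h₁)
  -- the point `ι P₁` occurs in `P₂ + ι P₃ + ι P₄`
  have key : ∀ x₃ y₃ x₄ y₄ : K, y₃ ^ 2 = f.eval x₃ → y₄ ^ 2 = f.eval x₄ →
      pointIdeal f x₁ (-y₁) * Ideal.span {AdjoinRoot.of _ r₁} =
        pointIdeal f x₂ y₂ * (pointIdeal f x₃ (-y₃) * pointIdeal f x₄ (-y₄)) →
      pointIdeal f x₁ (-y₁) ∣ pointIdeal f x₃ (-y₃) →
      (x₁ = x₃ ∧ y₁ = y₃) ∧ (x₂ = x₄ ∧ y₂ = y₄) := by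
    intro x₃ y₃ x₄ y₄ h₃ h₄ hr₁ hdvd
    obtain ⟨rfl, hy⟩ := eq_of_pointIdeal_dvd (hconj h₁) (hconj h₃) hdvd
    obtain rfl := neg_injective hy
    rw [mul_left_comm] at hr₁
    obtain ⟨r₂, hr₂⟩ := exists_of_span_eq_mul h2 hsep h₂ (mul_left_cancel₀ (hne _ _) hr₁)
    obtain ⟨rfl, hy'⟩ := eq_of_pointIdeal_dvd (hconj h₂) (hconj h₄) (Dvd.intro _ hr₂)
    exact ⟨⟨rfl, rfl⟩, rfl, (neg_injective hy').symm⟩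
  rcases hp.dvd_or_dvd (Dvd.intro _ hr₁) with hd | hd
  · exact absurd (eq_of_pointIdeal_dvd (hconj h₁) h₂ hd) hgp
  rcases hp.dvd_or_dvd hd with hd | hd
  · exact Or.inl (key x₃ y₃ x₄ y₄ h₃ h₄ hr₁ hd)
  · exact Or.inr (key x₄ y₄ x₃ y₃ h₄ h₃ (by rw [hr₁, mul_comm (pointIdeal f x₃ _)]) hd)

end Uniqueness

/-! ### The Galois action on divisors -/

section Conjugation

variable {k K : Type*} [Field k] [Field K] [Algebra k K]

theorem map_baseChange (σ : K ≃ₐ[k] K) (f : k[X]) :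
    (baseChange K f).map (σ : K →+* K) = baseChange K f := by
  rw [Polynomial.map_map]
  congr 1
  ext x
  simp

theorem curve_conj {f : k[X]} (σ : K ≃ₐ[k] K) {x y : K} (h : y ^ 2 = (baseChange K f).eval x) :
    (σ y) ^ 2 = (baseChange K f).eval (σ x) := by
  rw [← map_pow, h, eval_map_algebraMap, eval_map_algebraMap]
  exact (aeval_algHom_apply (σ : K →ₐ[k] K) x f).symm

/-- An automorphism of `K` acting on the coefficients of functions on `y² = g(x)`, where its
effect on `g` is trivial, takes the ideal of a point into the ideal of the conjugate point. -/
theorem coordFun_map_mem {g a b : K[X]} (σ : K →+* K) (hg : g.map σ = g) {x y : K} {n : ℕ}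
    (h : coordFun g a b ∈ pointIdeal g x y ^ n) :
    coordFun g (a.map σ) (b.map σ) ∈ pointIdeal g (σ x) (σ y) ^ n := by
  let φ : CoordRing g →+* CoordRing g := AdjoinRoot.map (mapRingHom σ) _ _ (by simp [hg])
  have hφ := Ideal.mem_map_of_mem φ h
  rw [Ideal.map_pow, pointIdeal_eq_span, Ideal.map_span, Set.image_pair] at hφ
  simpa [φ, coordFun_eq, pointIdeal_eq_span] using hφ

/-- The form obtained by the action of an automorphism on the coefficients. -/
noncomputable def CurveForm.conj {e : ℕ} (σ : K →+* K) (G : CurveForm K e) : CurveForm K e where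
  a := G.a.map σ
  b := G.b.map σ
  natDegree_a := natDegree_map_le.trans G.natDegree_a
  natDegree_b := natDegree_map_le.trans G.natDegree_b
  ne_zero := by
    rw [Ne, Ne, Polynomial.map_eq_zero, Polynomial.map_eq_zero]
    exact G.ne_zero

theorem coordFun_map_mem_iff {g a b : K[X]} (σ : K ≃ₐ[k] K)
    (hg : ∀ τ : K ≃ₐ[k] K, g.map (τ : K →+* K) = g) {x y : K} {n : ℕ} :
    coordFun g (a.map (σ : K →+* K)) (b.map (σ : K →+* K)) ∈ pointIdeal g (σ x) (σ y) ^ n ↔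
      coordFun g a b ∈ pointIdeal g x y ^ n := by
  refine ⟨fun h => ?_, fun h => coordFun_map_mem (σ : K →+* K) (hg σ) h⟩
  have hcomp : ((σ.symm : K ≃ₐ[k] K) : K →+* K).comp (σ : K →+* K) = RingHom.id K := by
    ext z
    simp
  have := coordFun_map_mem ((σ.symm : K ≃ₐ[k] K) : K →+* K) (hg σ.symm) h
  simpa [Polynomial.map_map, hcomp] using this

theorem HasOrderAt.conj {f : k[X]} (σ : K ≃ₐ[k] K) {e n : ℕ} {G : CurveForm K e}
    {P : Pt (baseChange K f)} (h : HasOrderAt G n P) :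
    HasOrderAt (G.conj (σ : K →+* K)) n (Pt.conj σ P) := by
  have hf := fun τ : K ≃ₐ[k] K => map_baseChange τ f
  cases P with
  | affine x y hP =>
    exact ⟨(coordFun_map_mem_iff σ hf).mpr h.1,
      (coordFun_map_mem_iff σ hf).not.mpr h.2⟩
  | infinity w hw =>
    have hf' : ∀ τ : K ≃ₐ[k] K, ((baseChange K f).reflect 8).map (τ : K →+* K) =
        (baseChange K f).reflect 8 := fun τ => by rw [← reflect_map, hf]
    have h1 := (coordFun_map_mem_iff σ hf' (n := n)).mpr h.1
    have h2 := (coordFun_map_mem_iff σ hf' (n := n + 1)).not.mpr h.2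
    rw [← reflect_map, ← reflect_map, map_zero] at h1 h2
    exact ⟨h1, h2⟩

theorem Pt.conj_conj_symm {f : k[X]} (σ : K ≃ₐ[k] K) (P : Pt (baseChange K f)) :
    Pt.conj σ (Pt.conj σ.symm P) = P := by
  cases P <;> simp [Pt.conj]

theorem Pt.conj_injective {f : k[X]} (σ : K ≃ₐ[k] K) :
    Function.Injective (Pt.conj σ : Pt (baseChange K f) → Pt (baseChange K f)) :=
  Function.LeftInverse.injective (g := Pt.conj σ.symm) fun P => Pt.conj_conj_symm σ.symm P

theorem divConj_single {f : k[X]} (σ : K ≃ₐ[k] K) (P : Pt (baseChange K f)) (n : ℤ) :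
    divConj σ (Finsupp.single P n) = Finsupp.single (Pt.conj σ P) n :=
  Finsupp.mapDomain_single

theorem divConj_add {f : k[X]} (σ : K ≃ₐ[k] K) (D D' : Divisor (baseChange K f)) :
    divConj σ (D + D') = divConj σ D + divConj σ D' :=
  Finsupp.mapDomain_add

theorem divConj_neg {f : k[X]} (σ : K ≃ₐ[k] K) (D : Divisor (baseChange K f)) :
    divConj σ (-D) = -divConj σ D :=
  map_neg (Finsupp.mapDomain.addMonoidHom (Pt.conj σ)) D

theorem divConj_sub {f : k[X]} (σ : K ≃ₐ[k] K) (D D' : Divisor (baseChange K f)) :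
    divConj σ (D - D') = divConj σ D - divConj σ D' := by
  rw [sub_eq_add_neg, divConj_add, divConj_neg, ← sub_eq_add_neg]

theorem divConj_mem_principalDivisors {f : k[X]} (σ : K ≃ₐ[k] K) {D : Divisor (baseChange K f)}
    (h : D ∈ principalDivisors (baseChange K f)) :
    divConj σ D ∈ principalDivisors (baseChange K f) := by
  induction h using AddSubgroup.closure_induction with
  | mem D h =>
    obtain ⟨e, G, H, hD⟩ := h
    refine AddSubgroup.subset_closure ⟨e, G.conj (σ : K →+* K), H.conj (σ : K →+* K), fun P => ?_⟩
    obtain ⟨m, n, hm, hn, h⟩ := hD (Pt.conj σ.symm P)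
    refine ⟨m, n, ?_, ?_, ?_⟩
    · simpa only [Pt.conj_conj_symm] using hm.conj σ
    · simpa only [Pt.conj_conj_symm] using hn.conj σ
    · rw [← h, divConj]
      nth_rw 1 [← Pt.conj_conj_symm σ P]
      exact Finsupp.mapDomain_apply (Pt.conj_injective σ) _ _
  | zero => simp [divConj]
  | add D D' _ _ h h' => rw [divConj_add]; exact add_mem h h'
  | neg D _ h => rw [divConj_neg]; exact neg_mem h

/-- The divisor at infinity is defined over `k`. -/
theorem divConj_divInfty [IsAlgClosed K] {f : k[X]} (σ : K ≃ₐ[k] K) :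
    divConj σ (divInfty (baseChange K f)) = divInfty (baseChange K f) := by
  have key : ∀ (w : K) (h : w ^ 2 = (baseChange K f).coeff 8),
      divConj σ (Finsupp.single (Pt.infinity w h) 1 + Finsupp.single (Pt.infinity w h).inv 1) =
        Finsupp.single (Pt.infinity w h) 1 + Finsupp.single (Pt.infinity w h).inv 1 := by
    intro w h
    have hσ : (σ w) ^ 2 = w ^ 2 := by
      rw [← map_pow, h, coeff_map, AlgEquiv.commutes]
    rw [divConj_add, divConj_single, divConj_single]
    rcases sq_eq_sq_iff_eq_or_eq_neg.mp hσ with h' | h'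
    · simp [Pt.conj, Pt.inv, h']
    · rw [add_comm]
      simp [Pt.conj, Pt.inv, h']
  exact key _ _

end Conjugation

/-! ### Separability and rationality of coordinates -/

section Separability

variable {k K : Type*} [Field k] [Field K] [Algebra k K]

theorem mem_separableClosure_of_sq_mem (h2 : (2 : K) ≠ 0) {u : K}
    (h : u ^ 2 ∈ separableClosure k K) : u ∈ separableClosure k K := by
  by_cases hu : u = 0
  · rw [hu]
    exact zero_mem _
  let c : separableClosure k K := ⟨u ^ 2, h⟩
  have hc : c ≠ 0 := fun h0 => pow_ne_zero 2 hu (congrArg Subtype.val h0)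
  have h2' : ((2 : ℕ) : separableClosure k K) ≠ 0 := fun h0 => h2 (by
    rw [← Nat.cast_ofNat]
    exact congrArg Subtype.val h0)
  have hsep : IsSeparable (separableClosure k K) u :=
    (separable_X_pow_sub_C c h2' hc).of_dvd (minpoly.dvd _ _ (by
      simp only [map_sub, map_pow, aeval_X, aeval_C]
      exact sub_self _))
  exact mem_separableClosure_iff.mpr (hsep.of_algebra_isSeparable_of_isSeparable k)

theorem algebraMap_mem_separableClosure (c : k) : algebraMap k K c ∈ separableClosure k K :=
  (separableClosure k K).algebraMap_mem c

/-- Two elements with sum and product in `k` are separable over `k`, in characteristic not `2`. -/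
theorem mem_separableClosure_of_add_mul (h2 : (2 : K) ≠ 0) {x₁ x₂ : K}
    (hs : x₁ + x₂ ∈ (algebraMap k K).range) (hp : x₁ * x₂ ∈ (algebraMap k K).range) :
    x₁ ∈ separableClosure k K := by
  obtain ⟨s, hs⟩ := hs
  obtain ⟨p, hp⟩ := hp
  have hsub : x₁ - x₂ ∈ separableClosure k K := by
    refine mem_separableClosure_of_sq_mem h2 ?_
    rw [show (x₁ - x₂) ^ 2 = algebraMap k K (s ^ 2 - 4 * p) by
      rw [map_sub, map_mul, map_pow, hs, hp, map_ofNat]; ring]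
    exact algebraMap_mem_separableClosure _
  have h2' : (2 : K) ∈ separableClosure k K := by
    rw [← map_ofNat (algebraMap k K) 2]
    exact algebraMap_mem_separableClosure _
  rw [show x₁ = ((x₁ + x₂) + (x₁ - x₂)) / 2 by field_simp; ring, ← hs]
  exact div_mem (add_mem (algebraMap_mem_separableClosure s) hsub) h2'

theorem mem_separableClosure_of_sq_eq_eval (h2 : (2 : K) ≠ 0) {f : k[X]} {x y : K}
    (h : y ^ 2 = (baseChange K f).eval x) (hx : x ∈ separableClosure k K) :
    y ∈ separableClosure k K := by
  refine mem_separableClosure_of_sq_mem h2 ?_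
  rw [h, eval_map_algebraMap, aeval_eq_sum_range]
  refine sum_mem fun i _ => ?_
  rw [Algebra.smul_def]
  exact mul_mem (algebraMap_mem_separableClosure _) (pow_mem hx _)

theorem mem_range_of_forall_fixed [Normal k K] {z : K} (hz : z ∈ separableClosure k K)
    (h : ∀ σ : K ≃ₐ[k] K, σ z = z) : z ∈ (algebraMap k K).range := by
  obtain ⟨c, hc⟩ := (InfiniteGalois.mem_range_algebraMap_iff_fixed
    (⟨z, hz⟩ : separableClosure k K)).mpr fun τ => Subtype.ext
      ((τ.liftNormal_commutes K ⟨z, hz⟩).symm.trans (h (τ.liftNormal K)))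
  exact ⟨c, congrArg Subtype.val hc⟩

end Separability

/-! ### Rationality of classes of degree two -/

section Rationality

variable {k K : Type*} [Field k] [Field K] [Algebra k K]

theorem ne_inv_of_inGeneralPosition {f : K[X]} {x₁ y₁ x₂ y₂ : K} {h₁ : y₁ ^ 2 = f.eval x₁}
    {h₂ : y₂ ^ 2 = f.eval x₂} (h : InGeneralPosition (Finsupp.single (Pt.affine x₁ y₁ h₁) 1 +
      Finsupp.single (Pt.affine x₂ y₂ h₂) 1 : Divisor f)) : ¬ (x₂ = x₁ ∧ y₂ = -y₁) := by
  rintro ⟨rfl, rfl⟩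
  exact h.2 ⟨Pt.affine x₂ y₁ h₁, le_rfl⟩

/-- The sum `y₁ + y₂` and, if `x₁ ≠ x₂`, the slope of the line through `(x₁, y₁)` and `(x₂, y₂)`
are in `k`. No condition on the slope is imposed if `x₁ = x₂`. -/
def SlopeCondition (k : Type*) {K : Type*} [Field k] [Field K] [Algebra k K] (x₁ y₁ x₂ y₂ : K) :
    Prop :=
  y₁ + y₂ ∈ (algebraMap k K).range ∧
    (x₁ = x₂ ∨ (x₁ ≠ x₂ ∧ (y₁ - y₂) / (x₁ - x₂) ∈ (algebraMap k K).range))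

theorem SlopeCondition.neg {x₁ y₁ x₂ y₂ : K} (h : SlopeCondition k x₁ y₁ x₂ y₂) :
    SlopeCondition k x₁ (-y₁) x₂ (-y₂) := by
  refine ⟨?_, h.2.imp_right (And.imp_right fun h => ?_)⟩
  · rw [← neg_add]
    exact neg_mem h.1
  · rw [← neg_sub', neg_div]
    exact neg_mem h

theorem SlopeCondition.swap {x₁ y₁ x₂ y₂ : K} (h : SlopeCondition k x₁ y₁ x₂ y₂) :
    SlopeCondition k x₂ y₂ x₁ y₁ := by
  refine ⟨add_comm y₁ y₂ ▸ h.1, h.2.imp Eq.symm (And.imp Ne.symm fun h => ?_)⟩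
  rwa [← neg_sub y₁, ← neg_sub x₁, neg_div_neg_eq]

theorem eq_and_eq_or_swap {x₁ x₂ a₁ a₂ : K} (hs : a₁ + a₂ = x₁ + x₂) (hp : a₁ * a₂ = x₁ * x₂) :
    (a₁ = x₁ ∧ a₂ = x₂) ∨ (a₁ = x₂ ∧ a₂ = x₁) := by
  have h : (a₁ - x₁) * (a₁ - x₂) = 0 := by linear_combination a₁ * hs - hp
  rcases mul_eq_zero.mp h with h | h
  · exact Or.inl ⟨sub_eq_zero.mp h, by linear_combination hs - h⟩
  · exact Or.inr ⟨sub_eq_zero.mp h, by linear_combination hs - h⟩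

/-- For points with rational `x₁ + x₂` and `x₁ x₂`, the slope condition expresses that the
divisor `(x₁, y₁) + (x₂, y₂)` is Galois-invariant. -/
theorem SlopeCondition.conj (h2 : (2 : K) ≠ 0) {f : k[X]} {x₁ y₁ x₂ y₂ : K}
    (h₁ : y₁ ^ 2 = (baseChange K f).eval x₁) (h₂ : y₂ ^ 2 = (baseChange K f).eval x₂)
    (hgp : ¬ (x₂ = x₁ ∧ y₂ = -y₁)) (hs : x₁ + x₂ ∈ (algebraMap k K).range)
    (hp : x₁ * x₂ ∈ (algebraMap k K).range) (h : SlopeCondition k x₁ y₁ x₂ y₂) (σ : K ≃ₐ[k] K) :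
    (σ x₁ = x₁ ∧ σ y₁ = y₁ ∧ σ x₂ = x₂ ∧ σ y₂ = y₂) ∨
      (σ x₁ = x₂ ∧ σ y₁ = y₂ ∧ σ x₂ = x₁ ∧ σ y₂ = y₁) := by
  have hfix : ∀ z ∈ (algebraMap k K).range, σ z = z := by
    rintro _ ⟨c, rfl⟩
    exact σ.commutes c
  have hys := hfix _ h.1
  have hxs := hfix _ hs
  have hxp := hfix _ hp
  rw [map_add] at hys hxs
  rw [map_mul] at hxp
  have hy : ∀ {a b c d : K}, a + b = c + d → a - b = c - d → a = c ∧ b = d := fun h h' =>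
    ⟨mul_left_cancel₀ h2 (by linear_combination h + h'),
      mul_left_cancel₀ h2 (by linear_combination h - h')⟩
  rcases h.2 with rfl | ⟨hne, hslope⟩
  · obtain rfl : y₂ = y₁ := by
      rcases sq_eq_sq_iff_eq_or_eq_neg.mp (h₂.trans h₁.symm) with h | h
      · exact h
      · exact absurd ⟨rfl, h⟩ hgp
    have hx : σ x₁ = x₁ := by
      rcases eq_and_eq_or_swap hxs hxp with h | h <;> exact h.1
    obtain ⟨hy1, -⟩ := hy hys (by rw [sub_self, sub_self])
    exact Or.inl ⟨hx, hy1, hx, hy1⟩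
  · have hsl := hfix _ hslope
    have hne' : x₁ - x₂ ≠ 0 := sub_ne_zero.mpr hne
    rw [map_div₀, map_sub, map_sub] at hsl
    rcases eq_and_eq_or_swap hxs hxp with ⟨hx1, hx2⟩ | ⟨hx1, hx2⟩
    · rw [hx1, hx2, div_left_inj' hne'] at hsl
      obtain ⟨hy1, hy2⟩ := hy hys hsl
      exact Or.inl ⟨hx1, hy1, hx2, hy2⟩
    · rw [hx1, hx2, ← neg_sub x₁ x₂, div_neg, ← neg_div, div_left_inj' hne'] at hsl
      obtain ⟨hy1, hy2⟩ := hy (hys.trans (add_comm _ _)) (show σ y₁ - σ y₂ = y₂ - y₁ by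
        linear_combination -hsl)
      exact Or.inr ⟨hx1, hy1, hx2, hy2⟩

/-- Galois invariance of the divisor `(x₁, y₁) + (x₂, y₂)` implies the slope condition. The field `k`
may be imperfect; but `x₁ + x₂` and `x₁ x₂` are in `k`, so that all four coordinates are
separable over `k`. -/
theorem slopeCondition_of_forall_conj [Normal k K] (h2 : (2 : K) ≠ 0) {f : k[X]} {x₁ y₁ x₂ y₂ : K}
    (h₁ : y₁ ^ 2 = (baseChange K f).eval x₁) (h₂ : y₂ ^ 2 = (baseChange K f).eval x₂)
    (hs : x₁ + x₂ ∈ (algebraMap k K).range) (hp : x₁ * x₂ ∈ (algebraMap k K).range)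
    (h : ∀ σ : K ≃ₐ[k] K, (σ x₁ = x₁ ∧ σ y₁ = y₁ ∧ σ x₂ = x₂ ∧ σ y₂ = y₂) ∨
      (σ x₁ = x₂ ∧ σ y₁ = y₂ ∧ σ x₂ = x₁ ∧ σ y₂ = y₁)) : SlopeCondition k x₁ y₁ x₂ y₂ := by
  have hx1 := mem_separableClosure_of_add_mul h2 hs hp
  have hx2 := mem_separableClosure_of_add_mul h2 (add_comm x₁ x₂ ▸ hs) (mul_comm x₁ x₂ ▸ hp)
  have hy1 := mem_separableClosure_of_sq_eq_eval h2 h₁ hx1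
  have hy2 := mem_separableClosure_of_sq_eq_eval h2 h₂ hx2
  refine ⟨mem_range_of_forall_fixed (add_mem hy1 hy2) fun σ => ?_,
    or_iff_not_imp_left.mpr fun hne => ⟨hne, mem_range_of_forall_fixed
      (div_mem (sub_mem hy1 hy2) (sub_mem hx1 hx2)) fun σ => ?_⟩⟩
  · rcases h σ with ⟨-, h1, -, h2⟩ | ⟨-, h1, -, h2⟩
    · rw [map_add, h1, h2]
    · rw [map_add, h1, h2, add_comm]
  · rw [map_div₀, map_sub, map_sub]
    rcases h σ with ⟨h1, h2, h3, h4⟩ | ⟨h1, h2, h3, h4⟩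
    · rw [h1, h2, h3, h4]
    · rw [h1, h2, h3, h4, ← neg_sub y₁, ← neg_sub x₁, neg_div_neg_eq]

theorem divClass_eq_iff {f : K[X]} {D D' : Divisor f} :
    divClass D = divClass D' ↔ D - D' ∈ principalDivisors f := by
  rw [divClass, divClass, QuotientAddGroup.mk'_apply, QuotientAddGroup.mk'_apply, eq_comm,
    QuotientAddGroup.eq, neg_add_eq_sub]

variable [IsAlgClosed K]

theorem isSep_of_mem_support_divInfty (h2 : (2 : K) ≠ 0) {f : k[X]} {P : Pt (baseChange K f)}
    (hP : P ∈ (divInfty (baseChange K f)).support) : P.IsSep k := by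
  classical
  have key : ∀ (w : K) (h : w ^ 2 = (baseChange K f).coeff 8), (Pt.infinity w h).IsSep k := by
    intro w h
    refine ⟨mem_separableClosure_iff.mp (one_mem _), mem_separableClosure_iff.mp (mem_separableClosure_of_sq_mem h2 ?_)⟩
    rw [show (Pt.infinity w h).y = w from rfl, h, coeff_map]
    exact algebraMap_mem_separableClosure _
  rcases Finset.mem_union.mp (Finsupp.support_add hP) with h | h
  · rw [Finset.mem_singleton.mp (Finsupp.support_single_subset h)]
    exact key _ _
  · rw [Finset.mem_singleton.mp (Finsupp.support_single_subset h)]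
    exact key _ _

variable [Algebra.IsAlgebraic k K]

/-- The rationality criterion for a single point of the Jacobian. As `(P₁) + (P₂)` is the only
divisor of its kind in its class, the class is Galois-invariant if and only if the divisor is. -/
theorem mem_rationalPoints_iff (hchar : (2 : k) ≠ 0) {f : k[X]} (hf : f.Separable)
    (hdeg : f.natDegree = 7 ∨ f.natDegree = 8) {Q : jac (baseChange K f)} {x₁ y₁ x₂ y₂ : K}
    {h₁ : y₁ ^ 2 = (baseChange K f).eval x₁} {h₂ : y₂ ^ 2 = (baseChange K f).eval x₂}
    (hQ : IsDegTwoRep Q (Pt.affine x₁ y₁ h₁) (Pt.affine x₂ y₂ h₂))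
    (hs : x₁ + x₂ ∈ (algebraMap k K).range) (hp : x₁ * x₂ ∈ (algebraMap k K).range) :
    Q ∈ rationalPoints K f ↔ SlopeCondition k x₁ y₁ x₂ y₂ := by
  classical
  have h2 : (2 : K) ≠ 0 := by
    rw [← map_ofNat (algebraMap k K) 2]
    exact (_root_.map_ne_zero _).mpr hchar
  have : IsAlgClosure k K := ⟨inferInstance, inferInstance⟩
  have : Normal k K := IsAlgClosure.normal k K
  have hgp := ne_inv_of_inGeneralPosition hQ.1
  constructor
  · rintro ⟨E, hE, -, hσE⟩
    refine slopeCondition_of_forall_conj h2 h₁ h₂ hs hp fun σ => ?_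
    have hdiff := divClass_eq_iff.mp (hE.symm.trans hQ.2)
    have hdiff' := divConj_mem_principalDivisors σ hdiff
    rw [divConj_sub, divConj_sub, divConj_divInfty, divConj_add, divConj_single,
      divConj_single] at hdiff'
    have hmem := sub_mem (sub_mem hdiff' hdiff) (divClass_eq_iff.mp (hσE σ))
    have huniq := eq_or_swap_of_linearEquiv (f := baseChange K f) h2 hf.map
      (by rwa [natDegree_map]) h₁ h₂ (curve_conj σ h₁) (curve_conj σ h₂) hgp
      (by
        convert hmem using 1
        simp only [Pt.conj]
        abel)
    rcases huniq with ⟨⟨a, b⟩, c, d⟩ | ⟨⟨a, b⟩, c, d⟩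
    · exact Or.inl ⟨a.symm, b.symm, c.symm, d.symm⟩
    · exact Or.inr ⟨c.symm, d.symm, a.symm, b.symm⟩
  · intro h
    have hx1 := mem_separableClosure_of_add_mul h2 hs hp
    have hx2 := mem_separableClosure_of_add_mul h2 (add_comm x₁ x₂ ▸ hs) (mul_comm x₁ x₂ ▸ hp)
    have hy1 := mem_separableClosure_of_sq_eq_eval h2 h₁ hx1
    have hy2 := mem_separableClosure_of_sq_eq_eval h2 h₂ hx2
    refine ⟨_, hQ.2, fun P hP => ?_, fun σ => congrArg divClass ?_⟩
    · rcases Finset.mem_union.mp (Finsupp.support_sub hP) with hP | hP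
      · rcases Finset.mem_union.mp (Finsupp.support_add hP) with hP | hP
        · rw [Finset.mem_singleton.mp (Finsupp.support_single_subset hP)]
          exact ⟨mem_separableClosure_iff.mp hx1, mem_separableClosure_iff.mp hy1⟩
        · rw [Finset.mem_singleton.mp (Finsupp.support_single_subset hP)]
          exact ⟨mem_separableClosure_iff.mp hx2, mem_separableClosure_iff.mp hy2⟩
      · exact isSep_of_mem_support_divInfty h2 hP
    · rw [divConj_sub, divConj_divInfty, divConj_add, divConj_single, divConj_single]
      congr 1
      rcases h.conj h2 h₁ h₂ hgp hs hp σ with ⟨a, b, c, d⟩ | ⟨a, b, c, d⟩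
      · simp only [Pt.conj, a, b, c, d]
      · simp only [Pt.conj, a, b, c, d]
        exact add_comm _ _

end Rationality

/-! ### The fibres of the map to the Kummer variety -/

section Kummer

variable {k K : Type*} [Field k] [Field K] [Algebra k K]

theorem polyG_comm (f : K[X]) (x₁ x₂ : K) : polyG f x₁ x₂ = polyG f x₂ x₁ := by
  rw [polyG, polyG, mul_comm x₁, add_comm x₁]

theorem xi₈_comm (f : K[X]) (x₁ y₁ x₂ y₂ : K) : xi₈ f x₁ y₁ x₂ y₂ = xi₈ f x₂ y₂ x₁ y₁ := by
  unfold xi₈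
  by_cases h : x₁ = x₂
  · rw [if_pos h, if_pos h.symm, h]
  · rw [if_neg h, if_neg (Ne.symm h), polyG_comm, mul_right_comm, ← neg_sub x₂, neg_sq]

/-- The coordinates `x₁ + x₂`, `x₁ x₂` and `ξ₈` of the image in the Kummer variety determine the two
points up to order and up to applying the hyperelliptic involution to both of them; the slope
condition is invariant under these changes. -/
theorem slopeCondition_of_coords_eq (h2 : (2 : K) ≠ 0) {f : K[X]} {x₁ y₁ x₂ y₂ a₁ b₁ a₂ b₂ : K}
    (h₁ : y₁ ^ 2 = f.eval x₁) (h₂ : y₂ ^ 2 = f.eval x₂)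
    (h₁' : b₁ ^ 2 = f.eval a₁) (h₂' : b₂ ^ 2 = f.eval a₂)
    (hgp : ¬ (x₂ = x₁ ∧ y₂ = -y₁)) (hgp' : ¬ (a₂ = a₁ ∧ b₂ = -b₁))
    (hs : a₁ + a₂ = x₁ + x₂) (hp : a₁ * a₂ = x₁ * x₂)
    (hxi : xi₈ f a₁ b₁ a₂ b₂ = xi₈ f x₁ y₁ x₂ y₂) (h : SlopeCondition k x₁ y₁ x₂ y₂) :
    SlopeCondition k a₁ b₁ a₂ b₂ := by
  wlog hx : a₁ = x₁ ∧ a₂ = x₂ generalizing x₁ y₁ x₂ y₂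
  · refine this h₂ h₁ (fun h' => hgp ⟨h'.1.symm, by rw [h'.2, neg_neg]⟩) (hs.trans (add_comm _ _))
      (hp.trans (mul_comm _ _)) (hxi.trans (xi₈_comm _ _ _ _ _)) h.swap ?_
    exact (eq_and_eq_or_swap hs hp).resolve_left hx
  obtain ⟨rfl, rfl⟩ := hx
  have e1 := sq_eq_sq_iff_eq_or_eq_neg.mp (h₁'.trans h₁.symm)
  have e2 := sq_eq_sq_iff_eq_or_eq_neg.mp (h₂'.trans h₂.symm)
  by_cases hne : a₁ = a₂
  · obtain rfl := hne
    obtain rfl : y₂ = y₁ := by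
      rcases sq_eq_sq_iff_eq_or_eq_neg.mp (h₂.trans h₁.symm) with h | h
      · exact h
      · exact absurd ⟨rfl, h⟩ hgp
    obtain rfl : b₂ = b₁ := by
      rcases sq_eq_sq_iff_eq_or_eq_neg.mp (h₂'.trans h₁'.symm) with h | h
      · exact h
      · exact absurd ⟨rfl, h⟩ hgp'
    rcases e1 with rfl | rfl
    · exact h
    · exact h.neg
  · -- here `ξ₈` determines the product of the `y`-coordinates
    have hprod : b₁ * b₂ = y₁ * y₂ := by
      unfold xi₈ at hxi
      rw [if_neg hne, if_neg hne, div_left_inj' (pow_ne_zero 2 (sub_ne_zero.mpr hne))] at hxi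
      exact mul_left_cancel₀ h2 (by linear_combination hxi)
    rcases e1 with rfl | rfl <;> rcases e2 with rfl | rfl
    · exact h
    · have : b₁ * y₂ = 0 := mul_left_cancel₀ h2 (by linear_combination -hprod)
      rcases mul_eq_zero.mp this with rfl | rfl
      · simpa using h.neg
      · simpa using h
    · have : y₁ * b₂ = 0 := mul_left_cancel₀ h2 (by linear_combination -hprod)
      rcases mul_eq_zero.mp this with rfl | rfl
      · simpa using h
      · simpa using h.neg
    · exact h.neg

variable [IsAlgClosed K]

/-- The point `Q` of the Jacobian is represented by two affine points, and these determine the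
coordinates of `κ(Q)`, as soon as `ξ₁ = 0` and `ξ₂ ≠ 0`. -/
theorem exists_rep_of_kappa_eq {f : k[X]} {ξ : Fin 8 → k} {hξ : ξ ≠ 0} (hξ₁ : ξ 0 = 0)
    (hξ₂ : ξ 1 ≠ 0) {Q : jac (baseChange K f)} (hQ : kappa (baseChange K f) Q = ratPoint K ξ hξ) :
    ∃ (x₁ y₁ x₂ y₂ : K) (h₁ : y₁ ^ 2 = (baseChange K f).eval x₁)
      (h₂ : y₂ ^ 2 = (baseChange K f).eval x₂),
      IsDegTwoRep Q (Pt.affine x₁ y₁ h₁) (Pt.affine x₂ y₂ h₂) ∧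
      x₁ + x₂ = algebraMap k K (-(ξ 2 / ξ 1)) ∧ x₁ * x₂ = algebraMap k K (ξ 3 / ξ 1) ∧
      xi₈ (baseChange K f) x₁ y₁ x₂ y₂ = algebraMap k K (ξ 7 / ξ 1) := by
  obtain ⟨c, hc⟩ := (Projectivization.mk_eq_mk_iff' _ _ _ _ _).mp hQ
  have hc' : ∀ i, c * algebraMap k K (ξ i) = kummerCoords Q i := fun i => congrFun hc i
  have hξ₂' : algebraMap k K (ξ 1) ≠ 0 := (_root_.map_ne_zero _).mpr hξ₂
  have hc0 : c ≠ 0 := by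
    rintro rfl
    exact kummerCoords_ne_zero Q (funext fun i => by rw [← hc' i, zero_mul, Pi.zero_apply])
  have h0 : kummerCoords Q 0 = 0 := by rw [← hc', hξ₁, map_zero, mul_zero]
  have h1 : kummerCoords Q 1 ≠ 0 := by
    rw [← hc']
    exact mul_ne_zero hc0 hξ₂'
  unfold kummerCoords at h0 h1 hc'
  split_ifs at h0 h1 hc' with hQ0 hrep
  · simp at h1
  · have hspec := hrep.choose_spec
    generalize hrep.choose = P at *
    obtain ⟨P₁, P₂⟩ := P
    rcases P₁ with ⟨x₁, y₁, h₁⟩ | ⟨w, h₁⟩ <;> rcases P₂ with ⟨x₂, y₂, h₂⟩ | ⟨w', h₂⟩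
    · refine ⟨x₁, y₁, x₂, y₂, h₁, h₂, hspec, ?_⟩
      have e1 : c * algebraMap k K (ξ 1) = 1 := hc' 1
      have e2 : c * algebraMap k K (ξ 2) = -(x₁ + x₂) := hc' 2
      have e3 : c * algebraMap k K (ξ 3) = x₁ * x₂ := hc' 3
      have e7 : c * algebraMap k K (ξ 7) = xi₈ (baseChange K f) x₁ y₁ x₂ y₂ := hc' 7
      rw [map_neg, map_div₀, map_div₀, map_div₀]
      have hcinv : c = (algebraMap k K (ξ 1))⁻¹ := eq_inv_of_mul_eq_one_left e1
      subst hcinv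
      refine ⟨?_, ?_, ?_⟩
      · linear_combination e2
      · linear_combination -e3
      · linear_combination -e7
    · simp [kummerCoordsTwo] at h1
    · simp [kummerCoordsTwo] at h1
    · simp [kummerCoordsTwo] at h1
  · simp [kummerCoordsFour] at h0

end Kummer

end G3Kummer

theorem lemmaL {k K : Type*} [Field k] [Field K] [Algebra k K] [IsAlgClosed K]
    [Algebra.IsAlgebraic k K] (hchar : (2 : k) ≠ 0)
    (f : Polynomial k) (hf : f.Separable) (hdeg : f.natDegree = 7 ∨ f.natDegree = 8)
    (ξ : Fin 8 → k) (hξ : ξ ≠ 0) (hξ₁ : ξ 0 = 0) (hξ₂ : ξ 1 ≠ 0)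
    (Q : G3Kummer.jac (G3Kummer.baseChange K f))
    (hQ : G3Kummer.kappa (G3Kummer.baseChange K f) Q = G3Kummer.ratPoint K ξ hξ)
    (x₁ y₁ x₂ y₂ : K) (h₁ : y₁ ^ 2 = (G3Kummer.baseChange K f).eval x₁)
    (h₂ : y₂ ^ 2 = (G3Kummer.baseChange K f).eval x₂)
    (hD : G3Kummer.IsDegTwoRep Q (G3Kummer.Pt.affine x₁ y₁ h₁) (G3Kummer.Pt.affine x₂ y₂ h₂)) :
    G3Kummer.kappa (G3Kummer.baseChange K f) ⁻¹' {G3Kummer.ratPoint K ξ hξ} ⊆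
        G3Kummer.rationalPoints K f ↔
      y₁ + y₂ ∈ Set.range (algebraMap k K) ∧
        (x₁ = x₂ ∨ (x₁ ≠ x₂ ∧ (y₁ - y₂) / (x₁ - x₂) ∈ Set.range (algebraMap k K))) := by
  have h2 : (2 : K) ≠ 0 := by
    rw [← map_ofNat (algebraMap k K) 2]
    exact (_root_.map_ne_zero _).mpr hchar
  have hgp := G3Kummer.ne_inv_of_inGeneralPosition hD.1
  -- the representation used in the definition of `κ(Q)` is the given one, up to order
  obtain ⟨hs, hp, hxi⟩ : x₁ + x₂ = algebraMap k K (-(ξ 2 / ξ 1)) ∧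
      x₁ * x₂ = algebraMap k K (ξ 3 / ξ 1) ∧
      G3Kummer.xi₈ (G3Kummer.baseChange K f) x₁ y₁ x₂ y₂ = algebraMap k K (ξ 7 / ξ 1) := by
    obtain ⟨a₁, b₁, a₂, b₂, h₁', h₂', hrep, hs, hp, hxi⟩ :=
      G3Kummer.exists_rep_of_kappa_eq hξ₁ hξ₂ hQ
    have hmem := G3Kummer.divClass_eq_iff.mp (hD.2.symm.trans hrep.2)
    rw [sub_sub_sub_cancel_right] at hmem
    rcases G3Kummer.eq_or_swap_of_linearEquiv h2 hf.map (by rwa [Polynomial.natDegree_map])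
      h₁ h₂ h₁' h₂' hgp hmem with ⟨⟨rfl, rfl⟩, rfl, rfl⟩ | ⟨⟨rfl, rfl⟩, rfl, rfl⟩
    · exact ⟨hs, hp, hxi⟩
    · exact ⟨(add_comm _ _).trans hs, (mul_comm _ _).trans hp,
        (G3Kummer.xi₈_comm _ _ _ _ _).trans hxi⟩
  constructor
  · intro h
    exact (G3Kummer.mem_rationalPoints_iff hchar hf hdeg hD ⟨_, hs.symm⟩ ⟨_, hp.symm⟩).mp (h hQ)
  · intro h Q' hQ'
    obtain ⟨a₁, b₁, a₂, b₂, h₁', h₂', hrep, hs', hp', hxi'⟩ :=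
      G3Kummer.exists_rep_of_kappa_eq hξ₁ hξ₂ hQ'
    refine (G3Kummer.mem_rationalPoints_iff hchar hf hdeg hrep ⟨_, hs'.symm⟩ ⟨_, hp'.symm⟩).mpr ?_
    exact G3Kummer.slopeCondition_of_coords_eq h2 h₁ h₂ h₁' h₂' hgp
      (G3Kummer.ne_inv_of_inGeneralPosition hrep.1) (hs'.trans hs.symm) (hp'.trans hp.symm)
      (hxi'.trans hxi.symm) h
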